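/- **Setting.** Let $\mathcal H$ be a separable infinite-dimensional real Hilbert space, let $a\otimes b$ denote the operator $\zeta\mapsto\langle a,\zeta\rangle b$, and let $x_t,y_t,z_t,u_t,v_t$ ($t\ge1$) be mean-zero $\mathcal H$-valued random variables on a probability space such that, for bounded linear operators $\mathcal A,\mathcal B$ on $\mathcal H$, $$y_t=\mathcal Ax_t+u_t,\qquad x_t=\mathcal Bz_t+v_t,\qquad \mathbb E[z_t\otimes v_t]=0 .$$ For processes $a,b$ write $\mathcal C_{ab}=\mathbb E[a_t\otimes b_t]$ and $\widehat{\mathcal C}_{ab}=T^{-1}\sum_{t=1}^Ta_t\otimes b_t$; $\|\cdot\|_{op}$ and $\|\cdot\|_{HS}$ are the operator and Hilbert–Schmidt norms. **Standing assumptions.** (i) $(x_t,z_t)_{t\ge1}$ is strictly stationary and geometrically strongly mixing, with $\mathbb E\|x_t\|^2<\infty$ and $\mathbb E\|z_t\|^2<\infty$. (ii) With $\mathfrak F_t=\sigma(\{z_s\}_{s\le t+1},\{u_s\}_{s\le t})$: $\mathbb E[u_t\mid\mathfrak F_{t-1}]=0$, $\mathbb E[u_t\otimes u_t\mid\mathfrak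 F_{t-1}]=\mathcal C_{uu}$, and $\sup_t\mathbb E[\|u_t\|^{2+\delta}\mid\mathfrak F_{t-1}]<\infty$ a.s. for some $\delta>0$. (iii) $\mathcal C_{zz}=\sum_j\mu_jg_j\otimes g_j$ with $(g_j)$ orthonormal and $\mu_1>\mu_2>\dots>0$; the operator $\mathcal Q=\mathcal C_{xz}^*\mathcal C_{zz}^{-1}\mathcal C_{xz}=\sum_j\mu_j^{-1}(\mathcal C_{xz}^*g_j)\otimes(\mathcal C_{xz}^*g_j)$ satisfies $\ker\mathcal Q=\{0\}$ and $\mathcal Q=\sum_j\nu_jh_j\otimes h_j$ with $(h_j)$ orthonormal and $\nu_1>\nu_2>\dots>0$; and $\|\mathcal A\|_{HS}<\infty$. (iv) $\|\widehat{\mathcal C}_{xz}-\mathcal C_{xz}\|_{HS}$, $\|\widehat{\mathcal C}_{zz}-\mathcal C_{zz}\|_{HS}$, $\|\widehat{\mathcal C}_{uz}-\mathcal C_{uz}\|_{HS}$ and $\|\widehat{\mathcal C}_{vz}\|_{HS}$ are $O_p(T^{-1/2})$, and $\|\widehat{\mathcal C}_{uu}-\mathcal C_{uu}\|_{HS}=o_p(1)$.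 **Additional assumptions.** (v) There are constants $m_x,m_z,m_u$ such that a.s. $\sup_t\|x_t\|\le m_x$, $\sup_t\|z_t\|\le m_z$ and $\sup_t\|u_t\|\le m_u$. (vi) The ordered eigenvalues $M_j$ of the covariance operator of $z_t\otimes z_t-\mathcal C_{zz}$, a random element of the Hilbert space of Hilbert–Schmidt operators, satisfy $M_j\le ab^j$ for some $a>0$ and $0<b<1$. (vii) Either $\mathbb E[v_t\mid\mathcal G_{t-1}]=0$ for all $t$, where $\mathcal G_t=\sigma(\{z_s\}_{s\le t+1},\{v_s\}_{s\le t})$, or $\|\widehat{\mathcal C}_{vz}\|_{op}=O(T^{-1/2}\log T)$ a.s. **Estimator.** Let $\alpha_1=\alpha_1(T)>0$ and $\alpha_2=\alpha_2(T)>0$ tend to $0$ as $T\to\infty$. Let $\widehat{\mathcal C}_{zz}=\sum_j\hat\mu_j\hat g_j\otimes\hat g_j$ be a spectral decomposition with $\hat\mu_1\ge\hat\mu_2\ge\dots\ge0$ and $(\hat g_j)$ orthonormal, let $K_1=\#\{j:\hat\mu_j^2>\alpha_1\}$ and $(\widehat{\mathcal C}_{zz})^{-1}_{K_1}=\sum_{j\le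 K_1}\hat\mu_j^{-1}\hat g_j\otimes\hat g_j$, and put $$\widehat{\mathcal P}=\widehat{\mathcal C}_{yz}^*(\widehat{\mathcal C}_{zz})^{-1}_{K_1}\widehat{\mathcal C}_{xz},\qquad \widehat{\mathcal Q}=\widehat{\mathcal C}_{xz}^*(\widehat{\mathcal C}_{zz})^{-1}_{K_1}\widehat{\mathcal C}_{xz}.$$ Let $\widehat{\mathcal Q}=\sum_j\hat\nu_j\hat h_j\otimes\hat h_j$ be a spectral decomposition with $\hat\nu_1\ge\hat\nu_2\ge\dots\ge0$ and $(\hat h_j)$ orthonormal, let $K_2=\#\{j:\hat\nu_j^2>\alpha_2\}$ and $\widehat{\mathcal Q}^{-1}_{K_2}=\sum_{j\le K_2}\hat\nu_j^{-1}\hat h_j\otimes\hat h_j$. The functional two-stage least squares estimator (F2SLSE) is $\widetilde{\mathcal A}=\widehat{\mathcal P}\,\widehat{\mathcal Q}^{-1}_{K_2}$. Finally let $\tau_{1,j}=2\sqrt2\max\{(\mu_{j-1}-\mu_j)^{-1},(\mu_j-\mu_{j+1})^{-1}\}$ and $\tau_{2,j}=2\sqrt2\max\{(\nu_{j-1}-\nu_j)^{-1},(\nu_j-\nu_{j+1})^{-1}\}$,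 where for $j=1$ only the second term of each maximum is present. **Theorem.** Assume (i)–(vii) and, as $T\to\infty$, $$\Big(\sum_{j=1}^{K_1}\mu_j\tau_{1,j}\Big)\Big(\sum_{j=1}^{K_2}\tau_{2,j}\Big)=o\big(T^{1/2}\log^{-3/2}T\big)\ \text{a.s.},\qquad \Big(\sum_{j=K_1+1}^{\infty}\mu_j\Big)\Big(\sum_{j=1}^{K_2}\tau_{2,j}\Big)=o(1)\ \text{a.s.},$$ $\alpha_1\alpha_2^{-1}\to0$ and $\alpha_1^{-1}T^{-1}\log T\to0$. Then $\|\widetilde{\mathcal A}-\mathcal A\|_{op}\to0$ almost surely. -/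

import Mathlib

open MeasureTheory Filter Topology Asymptotics
open scoped ENNReal

noncomputable section

namespace FIV

/-! ### Operators on a real Hilbert space -/

section Operators

variable {H : Type*} [NormedAddCommGroup H] [InnerProductSpace ℝ H]

/-- The tensor product of two vectors: `a ⊗ b` is the operator `ζ ↦ ⟪a, ζ⟫ b`. -/
def tens (a b : H) : H →L[ℝ] H := InnerProductSpace.rankOne ℝ b a

theorem tens_apply (a b ζ : H) : tens a b ζ = inner ℝ a ζ • b := rfl

/-- `T = ∑ⱼ lam j • e j ⊗ e j` is a spectral decomposition of the (compact, self-adjoint,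
nonnegative) operator `T`: the eigenvalues are listed in nonincreasing order with multiplicity, and
the eigenvectors are orthonormal. The first eigenvalue is `lam 0`. -/
structure IsEigenSystem (T : H →L[ℝ] H) (lam : ℕ → ℝ) (e : ℕ → H) : Prop where
  orthonormal : Orthonormal ℝ e
  antitone : Antitone lam
  nonneg : ∀ j, 0 ≤ lam j
  tendsto_zero : Tendsto lam atTop (𝓝 0)
  hasSum : HasSum (fun j => lam j • tens (e j) (e j)) T

/-- The number of indices `j` with `(lam j)² > α`. -/
def numAbove (lam : ℕ → ℝ) (α : ℝ) : ℕ := Set.ncard {j | α < lam j ^ 2}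

/-- The regularized inverse based on the first `K` eigenelements. -/
def regInv (lam : ℕ → ℝ) (e : ℕ → H) (K : ℕ) : H →L[ℝ] H :=
  ∑ j ∈ Finset.range K, (lam j)⁻¹ • tens (e j) (e j)

/-- The reciprocal spectral gaps
`τ_j = 2√2 max {(lam_{j-1} - lam_j)⁻¹, (lam_j - lam_{j+1})⁻¹}`; for the first eigenvalue only the
gap to the second one is present. -/
def tau (lam : ℕ → ℝ) : ℕ → ℝ
  | 0 => 2 * √2 * (lam 0 - lam 1)⁻¹
  | j + 1 => 2 * √2 * max (lam j - lam (j + 1))⁻¹ (lam (j + 1) - lam (j + 2))⁻¹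

theorem parseval_enorm {ι : Type*} (b : HilbertBasis ι ℝ H) (v : H) :
    ∑' i, ‖inner ℝ v (b i)‖ₑ ^ 2 = ‖v‖ₑ ^ 2 := by
  have h := b.hasSum_inner_mul_inner v v
  have h2 : HasSum (fun i => ‖inner ℝ v (b i)‖ ^ 2) (‖v‖ ^ 2) := by
    rw [← real_inner_self_eq_norm_sq]
    refine h.congr_fun ?_ |> fun h => h
    intro i
    rw [real_inner_comm v (b i), Real.norm_eq_abs, sq_abs, sq]
  have h3 := ENNReal.ofReal_tsum_of_nonneg (fun i => sq_nonneg ‖inner ℝ v (b i)‖) h2.summable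
  rw [h2.tsum_eq] at h3
  simp only [ENNReal.ofReal_pow (norm_nonneg _), ofReal_norm] at h3
  exact h3.symm

variable [CompleteSpace H]

/-- An orthonormal basis of `H`, used to write down Hilbert–Schmidt norms and inner products,
which do not depend on it (see `hsNormSq_eq` and `hsInner_eq`). -/
def someBasis (H : Type*) [NormedAddCommGroup H] [InnerProductSpace ℝ H] [CompleteSpace H] :
    HilbertBasis (exists_hilbertBasis ℝ H).choose ℝ H :=
  (exists_hilbertBasis ℝ H).choose_spec.choose

/-- The square of the Hilbert–Schmidt norm, with value `∞` if `T` is not Hilbert–Schmidt. -/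
def hsNormSq (T : H →L[ℝ] H) : ℝ≥0∞ := ∑' i, ‖T (someBasis H i)‖ₑ ^ 2

/-- The Hilbert–Schmidt norm, with value `∞` if `T` is not Hilbert–Schmidt. -/
def hsNorm (T : H →L[ℝ] H) : ℝ≥0∞ := hsNormSq T ^ (1 / 2 : ℝ)

/-- `T` is a Hilbert–Schmidt operator. -/
def IsHS (T : H →L[ℝ] H) : Prop := hsNorm T < ∞

/-- The Hilbert–Schmidt inner product of two Hilbert–Schmidt operators. -/
def hsInner (S T : H →L[ℝ] H) : ℝ := ∑' i, inner ℝ (S (someBasis H i)) (T (someBasis H i))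

/-- `C_xz^* C_zz⁻¹ C_xz` for `C_zz = ∑ⱼ μ j • g j ⊗ g j`, where `C_zz⁻¹ = ∑ⱼ (μ j)⁻¹ • g j ⊗ g j`
is the unbounded inverse. -/
def popQ (Cxz : H →L[ℝ] H) (μ : ℕ → ℝ) (g : ℕ → H) : H →L[ℝ] H :=
  ∑' j, ContinuousLinearMap.adjoint Cxz ∘L ((μ j)⁻¹ • tens (g j) (g j)) ∘L Cxz

theorem tsum_enorm_adjoint {ι κ : Type*} (b : HilbertBasis ι ℝ H) (c : HilbertBasis κ ℝ H)
    (T : H →L[ℝ] H) :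
    ∑' i, ‖T (c i)‖ₑ ^ 2 = ∑' j, ‖ContinuousLinearMap.adjoint T (b j)‖ₑ ^ 2 := by
  calc ∑' i, ‖T (c i)‖ₑ ^ 2 = ∑' i, ∑' j, ‖inner ℝ (T (c i)) (b j)‖ₑ ^ 2 :=
        tsum_congr fun i => (parseval_enorm b _).symm
    _ = ∑' j, ∑' i, ‖inner ℝ (T (c i)) (b j)‖ₑ ^ 2 := ENNReal.tsum_comm
    _ = _ := tsum_congr fun j => by
        rw [← parseval_enorm c]
        refine tsum_congr fun i => ?_
        rw [← ContinuousLinearMap.adjoint_inner_right, real_inner_comm]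

/-- The Hilbert–Schmidt norm may be computed in any orthonormal basis. -/
theorem hsNormSq_eq {ι : Type*} (b : HilbertBasis ι ℝ H) (T : H →L[ℝ] H) :
    hsNormSq T = ∑' i, ‖T (b i)‖ₑ ^ 2 := by
  rw [hsNormSq, tsum_enorm_adjoint b (someBasis H) T, tsum_enorm_adjoint b b T]

theorem isHS_iff (T : H →L[ℝ] H) : IsHS T ↔ hsNormSq T < ∞ := by
  rw [IsHS, hsNorm, ENNReal.rpow_lt_top_iff_of_pos (by norm_num)]

theorem hasSum_normSq {ι : Type*} (b : HilbertBasis ι ℝ H) {T : H →L[ℝ] H} (hT : IsHS T) :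
    HasSum (fun i => ‖T (b i)‖ ^ 2) (hsNormSq T).toReal := by
  rw [isHS_iff, hsNormSq_eq b] at hT
  rw [hsNormSq_eq b]
  have h := ENNReal.hasSum_toReal hT.ne
  rw [ENNReal.tsum_toReal_eq fun i => ?_]
  · simpa only [ENNReal.toReal_pow, toReal_enorm] using h
  · exact ENNReal.pow_ne_top enorm_ne_top

theorem IsHS.add {S T : H →L[ℝ] H} (hS : IsHS S) (hT : IsHS T) : IsHS (S + T) := by
  rw [isHS_iff] at *
  have : hsNormSq (S + T) ≤ 2 * (hsNormSq S + hsNormSq T) := by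
    rw [hsNormSq, hsNormSq, hsNormSq, ← ENNReal.tsum_add, ← ENNReal.tsum_mul_left]
    refine ENNReal.tsum_le_tsum fun i => ?_
    set a := S (someBasis H i)
    set c := T (someBasis H i)
    have h1 : ‖a + c‖ ^ 2 ≤ 2 * (‖a‖ ^ 2 + ‖c‖ ^ 2) := by
      nlinarith [norm_add_le a c, norm_nonneg (a + c), sq_nonneg (‖a‖ - ‖c‖), norm_nonneg a,
        norm_nonneg c]
    have h2 := ENNReal.ofReal_le_ofReal h1
    rw [ENNReal.ofReal_mul (by norm_num), ENNReal.ofReal_add (by positivity) (by positivity),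
      ENNReal.ofReal_pow (norm_nonneg _), ENNReal.ofReal_pow (norm_nonneg _),
      ENNReal.ofReal_pow (norm_nonneg _), ofReal_norm, ofReal_norm, ofReal_norm] at h2
    simpa using h2
  exact this.trans_lt (ENNReal.mul_lt_top (by norm_num) (ENNReal.add_lt_top.2 ⟨hS, hT⟩))

theorem IsHS.neg {T : H →L[ℝ] H} (hT : IsHS T) : IsHS (-T) := by
  rw [isHS_iff] at *
  simpa [hsNormSq] using hT

theorem hasSum_hsInner {ι : Type*} (b : HilbertBasis ι ℝ H) {S T : H →L[ℝ] H} (hS : IsHS S)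
    (hT : IsHS T) : HasSum (fun i => inner ℝ (S (b i)) (T (b i)))
      (((hsNormSq (S + T)).toReal - (hsNormSq (S + -T)).toReal) / 4) := by
  have h := ((hasSum_normSq b (hS.add hT)).sub (hasSum_normSq b (hS.add hT.neg))).div_const 4
  refine h.congr_fun (fun i => ?_) |> fun h => h
  have h1 := norm_add_sq_real (S (b i)) (T (b i))
  have h2 := norm_sub_sq_real (S (b i)) (T (b i))
  have h3 : (S + T) (b i) = S (b i) + T (b i) := rfl
  have h4 : (S + -T) (b i) = S (b i) - T (b i) := (sub_eq_add_neg _ _).symm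
  rw [h3, h4]
  linarith

/-- The Hilbert–Schmidt inner product may be computed in any orthonormal basis. -/
theorem hsInner_eq {ι : Type*} (b : HilbertBasis ι ℝ H) {S T : H →L[ℝ] H} (hS : IsHS S)
    (hT : IsHS T) : hsInner S T = ∑' i, inner ℝ (S (b i)) (T (b i)) := by
  rw [hsInner, (hasSum_hsInner _ hS hT).tsum_eq, (hasSum_hsInner b hS hT).tsum_eq]

end Operators

/-! ### Probability -/

section Probability

variable {Ω : Type*} [MeasurableSpace Ω]

/-- `X_T = O_p(a_T)` for `[0, ∞]`-valued `X_T` and real `a_T`. -/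
def IsBigOp (P : Measure Ω) (X : ℕ → Ω → ℝ≥0∞) (a : ℕ → ℝ) : Prop :=
  ∀ ε : ℝ≥0∞, 0 < ε → ∃ M : ℝ, ∀ᶠ T in atTop, P {ω | ENNReal.ofReal (M * a T) < X T ω} ≤ ε

/-- `X_T = o_p(1)` for `[0, ∞]`-valued `X_T`. -/
def IsLittleOpOne (P : Measure Ω) (X : ℕ → Ω → ℝ≥0∞) : Prop :=
  ∀ ε : ℝ, 0 < ε → Tendsto (fun T => P {ω | ENNReal.ofReal ε < X T ω}) atTop (𝓝 0)

/-- (Strict) stationarity: the law of the sequence is invariant under the time shift. -/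
def IsStationary {E : Type*} [MeasurableSpace E] (P : Measure Ω) (w : ℕ → Ω → E) : Prop :=
  P.map (fun ω t => w (t + 1) ω) = P.map (fun ω t => w t ω)

/-- The events determined by `w t` for `t ∈ I`. -/
abbrev sigmaOn {E : Type*} [MeasurableSpace E] (w : ℕ → Ω → E) (I : Set ℕ) : MeasurableSpace Ω :=
  ⨆ t ∈ I, MeasurableSpace.comap (w t) inferInstance

/-- Geometric strong mixing: the `α`-mixing coefficients
`sup {|P(S ∩ S') - P(S) P(S')| : S ∈ σ(w_t, t ≤ n), S' ∈ σ(w_t, t ≥ n + k), n}` are at most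
`C ρ ^ k` for some `C` and some `ρ < 1`. -/
def IsGeomStronglyMixing {E : Type*} [MeasurableSpace E] (P : Measure Ω) (w : ℕ → Ω → E) : Prop :=
  ∃ C ρ : ℝ, 0 < ρ ∧ ρ < 1 ∧ ∀ k n : ℕ, ∀ S S' : Set Ω,
    MeasurableSet[sigmaOn w (Set.Iic n)] S → MeasurableSet[sigmaOn w (Set.Ici (n + k))] S' →
      |P.real (S ∩ S') - P.real S * P.real S'| ≤ C * ρ ^ k

variable {H : Type*} [NormedAddCommGroup H] [InnerProductSpace ℝ H]

/-- `σ({z_s}_{s ≤ t}, {e_s}_{s < t})`, the information available just before `e_t` is observed. -/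
abbrev past [MeasurableSpace H] (z e : ℕ → Ω → H) (t : ℕ) : MeasurableSpace Ω :=
  sigmaOn z (Set.Iic t) ⊔ sigmaOn e (Set.Iio t)

/-- The operator `E[a ⊗ b]`. -/
def crossCov (P : Measure Ω) (a b : Ω → H) : H →L[ℝ] H := ∫ ω, tens (a ω) (b ω) ∂P

/-- The operator `T⁻¹ ∑ a_t ⊗ b_t`, the sum being over the first `T` observations, which carry the
time indices `0, …, T - 1`. -/
def sampleCov (a b : ℕ → Ω → H) (T : ℕ) (ω : Ω) : H →L[ℝ] H :=
  (T : ℝ)⁻¹ • ∑ t ∈ Finset.range T, tens (a t ω) (b t ω)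

variable [CompleteSpace H]

/-- For a random Hilbert–Schmidt operator `D` with `E D = 0`: `M` lists the eigenvalues of the
covariance operator `Γ` of `D` as a random element of the Hilbert space of Hilbert–Schmidt
operators, in nonincreasing order, and `E` lists orthonormal eigenvectors, that is
`⟪Γ S, S'⟫ = E[⟪D, S⟫ ⟪D, S'⟫] = ∑ⱼ M j ⟪E j, S⟫ ⟪E j, S'⟫` for all Hilbert–Schmidt `S`, `S'`. -/
structure IsHSCovEigenSystem (P : Measure Ω) (D : Ω → H →L[ℝ] H) (M : ℕ → ℝ)
    (E : ℕ → H →L[ℝ] H) : Prop where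
  isHS : ∀ j, IsHS (E j)
  orthonormal : ∀ i j, hsInner (E i) (E j) = if i = j then 1 else 0
  antitone : Antitone M
  nonneg : ∀ j, 0 ≤ M j
  tendsto_zero : Tendsto M atTop (𝓝 0)
  hasSum : ∀ S S' : H →L[ℝ] H, IsHS S → IsHS S' →
    HasSum (fun j => M j * hsInner (E j) S * hsInner (E j) S')
      (∫ ω, hsInner (D ω) S * hsInner (D ω) S' ∂P)

/-! ### The estimator -/

/-- `Q̂ = Ĉ_xz^* (Ĉ_zz)_{K₁}⁻¹ Ĉ_xz`, where `(μ', g')` are the eigenelements of `Ĉ_zz`. -/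
def sampleQ (x z : ℕ → Ω → H) (μ' : ℕ → ℝ) (g' : ℕ → H) (K₁ T : ℕ) (ω : Ω) : H →L[ℝ] H :=
  ContinuousLinearMap.adjoint (sampleCov x z T ω) ∘L regInv μ' g' K₁ ∘L sampleCov x z T ω

/-- `P̂ = Ĉ_yz^* (Ĉ_zz)_{K₁}⁻¹ Ĉ_xz`. -/
def sampleP (x y z : ℕ → Ω → H) (μ' : ℕ → ℝ) (g' : ℕ → H) (K₁ T : ℕ) (ω : Ω) : H →L[ℝ] H :=
  ContinuousLinearMap.adjoint (sampleCov y z T ω) ∘L regInv μ' g' K₁ ∘L sampleCov x z T ω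

/-- The functional two-stage least squares estimator `P̂ Q̂_{K₂}⁻¹`, where `(μ', g')` and `(ν', h')`
are the eigenelements of `Ĉ_zz` and of `Q̂`. -/
def f2slse (x y z : ℕ → Ω → H) (μ' : ℕ → ℝ) (g' : ℕ → H) (ν' : ℕ → ℝ) (h' : ℕ → H)
    (K₁ K₂ T : ℕ) (ω : Ω) : H →L[ℝ] H :=
  sampleP x y z μ' g' K₁ T ω ∘L regInv ν' h' K₂

/-! ### The assumptions -/

variable [MeasurableSpace H]

/-- The standing assumptions on the functional linear model `y_t = A x_t + u_t` with first stage
`x_t = B z_t + v_t`. The time index starts at `0`; `(μ, g)` and `(ν, h)` are the eigenelements of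
`C_zz` and of `Q = C_xz^* C_zz⁻¹ C_xz`. -/
structure ModelAssumptions (P : Measure Ω) (A B : H →L[ℝ] H) (x y z u v : ℕ → Ω → H)
    (μ : ℕ → ℝ) (g : ℕ → H) (ν : ℕ → ℝ) (h : ℕ → H) : Prop where
  measurable_x : ∀ t, Measurable (x t)
  measurable_y : ∀ t, Measurable (y t)
  measurable_z : ∀ t, Measurable (z t)
  measurable_u : ∀ t, Measurable (u t)
  measurable_v : ∀ t, Measurable (v t)
  /-- the model -/
  model : ∀ t, ∀ᵐ ω ∂P, y t ω = A (x t ω) + u t ω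
  /-- the first stage -/
  first_stage : ∀ t, ∀ᵐ ω ∂P, x t ω = B (z t ω) + v t ω
  crossCov_zv : ∀ t, crossCov P (z t) (v t) = 0
  memLp_x : ∀ t, MemLp (x t) 2 P
  memLp_z : ∀ t, MemLp (z t) 2 P
  integrable_u : ∀ t, Integrable (u t) P
  mean_x : ∀ t, ∫ ω, x t ω ∂P = 0
  mean_z : ∀ t, ∫ ω, z t ω ∂P = 0
  mean_u : ∀ t, ∫ ω, u t ω ∂P = 0
  mean_v : ∀ t, ∫ ω, v t ω ∂P = 0
  stationary : IsStationary P fun t ω => (x t ω, z t ω)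
  mixing : IsGeomStronglyMixing P fun t ω => (x t ω, z t ω)
  /-- `u_t` is a homoscedastic martingale difference with bounded conditional moments -/
  martingale_u : ∀ t, P[u t | past z u t] =ᵐ[P] 0
  homoscedastic_u : ∀ t, P[fun ω => tens (u t ω) (u t ω) | past z u t]
    =ᵐ[P] fun _ => crossCov P (u 0) (u 0)
  moment_u : ∃ δ : ℝ, 0 < δ ∧ (∀ t, Integrable (fun ω => ‖u t ω‖ ^ (2 + δ)) P) ∧
    ∀ᵐ ω ∂P, BddAbove (Set.range fun t => (P[fun ω => ‖u t ω‖ ^ (2 + δ) | past z u t]) ω)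
  /-- eigenelements of `C_zz`, with distinct positive eigenvalues -/
  eigen_Czz : IsEigenSystem (crossCov P (z 0) (z 0)) μ g
  strictAnti_μ : StrictAnti μ
  pos_μ : ∀ j, 0 < μ j
  /-- eigenelements of `Q`, with distinct positive eigenvalues -/
  eigen_Q : IsEigenSystem (popQ (crossCov P (x 0) (z 0)) μ g) ν h
  strictAnti_ν : StrictAnti ν
  pos_ν : ∀ j, 0 < ν j
  /-- identification -/
  ker_Q : ∀ ζ, popQ (crossCov P (x 0) (z 0)) μ g ζ = 0 → ζ = 0
  isHS_A : IsHS A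
  /-- weak convergence rates of the sample operators -/
  rate_xz : IsBigOp P (fun T ω => hsNorm (sampleCov x z T ω - crossCov P (x 0) (z 0)))
    fun T => (T : ℝ) ^ (-1 / 2 : ℝ)
  rate_zz : IsBigOp P (fun T ω => hsNorm (sampleCov z z T ω - crossCov P (z 0) (z 0)))
    fun T => (T : ℝ) ^ (-1 / 2 : ℝ)
  rate_uz : IsBigOp P (fun T ω => hsNorm (sampleCov u z T ω - crossCov P (u 0) (z 0)))
    fun T => (T : ℝ) ^ (-1 / 2 : ℝ)
  rate_vz : IsBigOp P (fun T ω => hsNorm (sampleCov v z T ω)) fun T => (T : ℝ) ^ (-1 / 2 : ℝ)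
  rate_uu : IsLittleOpOne P fun T ω => hsNorm (sampleCov u u T ω - crossCov P (u 0) (u 0))

/-- The additional assumptions for strong consistency: bounded variables, geometrically decaying
eigenvalues of the covariance operator of `z_t ⊗ z_t - C_zz`, and either the martingale difference
property of `v_t` or an almost sure rate for `Ĉ_vz`. -/
structure StrongAssumptions (P : Measure Ω) (x z u v : ℕ → Ω → H) : Prop where
  bounded_x : ∃ m : ℝ, ∀ᵐ ω ∂P, ∀ t, ‖x t ω‖ ≤ m
  bounded_z : ∃ m : ℝ, ∀ᵐ ω ∂P, ∀ t, ‖z t ω‖ ≤ m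
  bounded_u : ∃ m : ℝ, ∀ᵐ ω ∂P, ∀ t, ‖u t ω‖ ≤ m
  decay : ∃ (M : ℕ → ℝ) (E : ℕ → H →L[ℝ] H),
    IsHSCovEigenSystem P (fun ω => tens (z 0 ω) (z 0 ω) - crossCov P (z 0) (z 0)) M E ∧
    ∃ a b : ℝ, 0 < a ∧ 0 < b ∧ b < 1 ∧ ∀ j, M j ≤ a * b ^ (j + 1)
  martingale_or_rate : (∀ t, P[v t | past z v t] =ᵐ[P] 0) ∨
    ∀ᵐ ω ∂P, (fun T : ℕ => ‖sampleCov v z T ω‖) =O[atTop]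
      fun T : ℕ => (T : ℝ) ^ (-1 / 2 : ℝ) * Real.log T

end Probability

end FIV

end

/-! Write `R₁`, `R₂` for the two regularized inverses and `Π` for the projection on the retained
eigenvectors of `Q̂`. Since `Q̂ R₂ = Π`, the error is exactly `(A Π - A) + Ĉ_uz^* R₁ Ĉ_xz R₂`
(`f2slse_sub_eq`): a bias and a noise term.

Noise. The quadratic form of `R₁` at `Ĉ_xz R₂ ζ` equals that of `Q̂` at `R₂ ζ`, which is at most
`α₂^(-1/2) ‖ζ‖²`. Hence the squared norm is at most `‖Ĉ_uz‖² α₁^(-1/2) α₂^(-1/2)`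
(`norm_noise_sq_le`). A maximal inequality on dyadic blocks gives `‖Ĉ_uz‖² = O(log T / T)` almost
surely (`ae_eventually_le_mul_log`), and eventually `α₁ ≤ α₂`, so the bound is of order `α₁⁻¹ log T
/ T`.

Bias. `A` is Hilbert–Schmidt, so it suffices that `Π` tends strongly to the identity
(`IsHS.tendsto_norm_comp_sub`). Comparing `Π` with the identity directly, on the dense range of the
injective self-adjoint `Q`, requires only `Q̂ → Q` in norm (`tendsto_sub_spanProj`).

Convergence of `Q̂`. Orthogonality of `z` and `v` gives `Q = B C_zz B^*`, while `Ĉ_xz = Ĉ_zz B^* +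
Ĉ_vz`. Expanding `Q̂` leaves the error of `Ĉ_zz`, a cut-off error `√α₁`, and terms in `Ĉ_vz`
(`norm_sandwich_sub_le`). The first vanishes by a strong law for bounded functions of a mixing
sequence, the last by the almost sure rate of `Ĉ_vz`. -/

namespace FIV

/-! ### Truncated spectral sums and spectral cut-offs -/

section DiagonalOperators

variable {H : Type*} [NormedAddCommGroup H] [InnerProductSpace ℝ H]

/-- The diagonal operator `∑_{j < K} c j • e j ⊗ e j`. -/
noncomputable def partialDiag (c : ℕ → ℝ) (e : ℕ → H) (K : ℕ) : H →L[ℝ] H :=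
  ∑ j ∈ Finset.range K, c j • tens (e j) (e j)

theorem regInv_eq_partialDiag (lam : ℕ → ℝ) (e : ℕ → H) (K : ℕ) :
    regInv lam e K = partialDiag (fun j => (lam j)⁻¹) e K := rfl

theorem partialDiag_apply (c : ℕ → ℝ) (e : ℕ → H) (K : ℕ) (w : H) :
    partialDiag c e K w = ∑ j ∈ Finset.range K, (c j * inner ℝ (e j) w) • e j := by
  simp [partialDiag, tens_apply, smul_smul]

theorem partialDiag_congr {c d : ℕ → ℝ} {e : ℕ → H} {K : ℕ} (h : ∀ j < K, c j = d j) :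
    partialDiag c e K = partialDiag d e K :=
  Finset.sum_congr rfl fun j hj => by rw [h j (Finset.mem_range.1 hj)]

theorem inner_partialDiag_apply (c : ℕ → ℝ) (e : ℕ → H) (K : ℕ) (w : H) :
    inner ℝ (partialDiag c e K w) w = ∑ j ∈ Finset.range K, c j * inner ℝ (e j) w ^ 2 := by
  rw [partialDiag_apply, sum_inner]
  refine Finset.sum_congr rfl fun j _ => ?_
  rw [real_inner_smul_left]
  ring

theorem norm_partialDiag_apply_sq {e : ℕ → H} (he : Orthonormal ℝ e) (c : ℕ → ℝ) (K : ℕ)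
    (w : H) :
    ‖partialDiag c e K w‖ ^ 2 = ∑ j ∈ Finset.range K, c j ^ 2 * inner ℝ (e j) w ^ 2 := by
  rw [← real_inner_self_eq_norm_sq, partialDiag_apply, he.inner_sum]
  refine Finset.sum_congr rfl fun j _ => ?_
  simp only [conj_trivial]
  ring

/-- Termwise `c² ≤ M c`. Keeping the quadratic form on the right, rather than `M² ‖w‖²`, is what
saves powers of the regularization parameters in the noise bound. -/
theorem norm_partialDiag_apply_sq_le_inner {e : ℕ → H} (he : Orthonormal ℝ e) {c : ℕ → ℝ} {K : ℕ}
    {M : ℝ} (h0 : ∀ j < K, 0 ≤ c j) (hM : ∀ j < K, c j ≤ M) (w : H) :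
    ‖partialDiag c e K w‖ ^ 2 ≤ M * inner ℝ (partialDiag c e K w) w := by
  rw [norm_partialDiag_apply_sq he, inner_partialDiag_apply, Finset.mul_sum]
  refine Finset.sum_le_sum fun j hj => ?_
  have h1 := h0 j (Finset.mem_range.1 hj)
  have h2 := hM j (Finset.mem_range.1 hj)
  nlinarith [mul_nonneg (mul_nonneg h1 (sub_nonneg.2 h2)) (sq_nonneg (inner ℝ (e j) w))]

theorem norm_partialDiag_le {e : ℕ → H} (he : Orthonormal ℝ e) {c : ℕ → ℝ} {K : ℕ} {M : ℝ}
    (hM0 : 0 ≤ M) (hM : ∀ j < K, |c j| ≤ M) : ‖partialDiag c e K‖ ≤ M := by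
  refine ContinuousLinearMap.opNorm_le_bound _ hM0 fun w => ?_
  refine abs_le_of_sq_le_sq' ?_ (by positivity) |>.2
  rw [norm_partialDiag_apply_sq he, mul_pow]
  calc _ ≤ ∑ j ∈ Finset.range K, M ^ 2 * inner ℝ (e j) w ^ 2 :=
        Finset.sum_le_sum fun j hj => by
          have := sq_le_sq' (by linarith [abs_nonneg (c j), hM j (Finset.mem_range.1 hj)])
            (hM j (Finset.mem_range.1 hj))
          rw [sq_abs] at this
          gcongr
    _ = M ^ 2 * ∑ j ∈ Finset.range K, ‖inner ℝ (e j) w‖ ^ 2 := by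
        simp [Finset.mul_sum]
    _ ≤ _ := by
        gcongr
        exact he.sum_inner_products_le w


variable {T : H →L[ℝ] H} {lam : ℕ → ℝ} {e : ℕ → H}

theorem IsEigenSystem.tendsto_partialDiag (h : IsEigenSystem T lam e) :
    Tendsto (partialDiag lam e) atTop (𝓝 T) := h.hasSum.tendsto_sum_nat

theorem IsEigenSystem.apply_eq (h : IsEigenSystem T lam e) (k : ℕ) : T (e k) = lam k • e k := by
  have h1 := h.hasSum.mapL (ContinuousLinearMap.apply ℝ H (e k))
  refine h1.unique ?_
  convert hasSum_single k ?_ using 1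
  · simp [tens_apply, h.orthonormal.1 k]
  · intro j hj
    simp [tens_apply, h.orthonormal.2 hj]

theorem IsEigenSystem.comp_partialDiag (h : IsEigenSystem T lam e) (c : ℕ → ℝ) (K : ℕ) :
    T ∘L partialDiag c e K = partialDiag (fun j => lam j * c j) e K := by
  ext w
  rw [ContinuousLinearMap.comp_apply, partialDiag_apply, partialDiag_apply, map_sum]
  refine Finset.sum_congr rfl fun j _ => ?_
  rw [map_smul, h.apply_eq, smul_smul]
  congr 1
  ring

/-- The remainder is a norm limit of diagonal sums whose coefficients vanish below `K`, each of norm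
at most `s`. -/
theorem IsEigenSystem.norm_sub_partialDiag_le (h : IsEigenSystem T lam e) {K : ℕ} {s : ℝ}
    (hs0 : 0 ≤ s) (hs : ∀ j, K ≤ j → lam j ≤ s) : ‖T - partialDiag lam e K‖ ≤ s := by
  refine le_of_tendsto (h.tendsto_partialDiag.sub_const _).norm ?_
  filter_upwards [eventually_ge_atTop K] with n hn
  have : partialDiag lam e n - partialDiag lam e K
      = partialDiag (fun j => if j < K then 0 else lam j) e n := by
    rw [partialDiag, partialDiag, partialDiag, ← Finset.sum_range_add_sum_Ico _ hn,
      ← Finset.sum_range_add_sum_Ico (fun j => (if j < K then 0 else lam j) • _) hn,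
      add_sub_cancel_left, Finset.sum_eq_zero (s := Finset.range K), zero_add]
    · refine Finset.sum_congr rfl fun j hj => ?_
      rw [if_neg (Finset.mem_Ico.1 hj).1.not_gt]
    · intro j hj
      rw [if_pos (Finset.mem_range.1 hj), zero_smul]
  rw [this]
  refine norm_partialDiag_le h.orthonormal hs0 fun j _ => ?_
  split_ifs with hj
  · simpa
  · rw [abs_of_nonneg (h.nonneg j)]
    exact hs j (not_lt.1 hj)

/-- The indices counted form an initial segment by monotonicity, hence are determined by their
number. Finiteness, from `lam → 0` and `α > 0`, matters because `Set.ncard` of an infinite set is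
`0`. -/
theorem IsEigenSystem.lt_numAbove_iff (h : IsEigenSystem T lam e) {α : ℝ} (hα : 0 < α) (j : ℕ) :
    j < numAbove lam α ↔ α < lam j ^ 2 := by
  set S := {j | α < lam j ^ 2} with hS
  have hfin : S.Finite := by
    have h1 : Tendsto (fun j => lam j ^ 2) atTop (𝓝 0) := by
      simpa using h.tendsto_zero.pow 2
    obtain ⟨N, hN⟩ := eventually_atTop.1 (h1.eventually_lt_const hα)
    refine (Set.finite_lt_nat N).subset fun j hj => ?_
    by_contra hle
    exact (hN j (not_lt.1 hle)).not_gt hj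
  have hlow : ∀ i j, i ≤ j → j ∈ S → i ∈ S := fun i j hij hj =>
    lt_of_lt_of_le hj (pow_le_pow_left₀ (h.nonneg j) (h.antitone hij) 2)
  change j < S.ncard ↔ j ∈ S
  constructor
  · intro hj
    by_contra hn
    have : S ⊆ Set.Iio j := fun i hi => by
      by_contra hle
      exact hn (hlow j i (not_lt.1 hle) hi)
    have := Set.ncard_le_ncard this (Set.finite_Iio j)
    rw [Set.ncard_eq_toFinset_card' (Set.Iio j)] at this
    simp at this
    omega
  · intro hj
    have : Set.Iic j ⊆ S := fun i hi => hlow i j hi hj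
    have := Set.ncard_le_ncard this hfin
    rw [Set.ncard_eq_toFinset_card' (Set.Iic j)] at this
    simp at this
    omega

variable {α : ℝ} {K : ℕ}

theorem IsEigenSystem.sqrt_lt (h : IsEigenSystem T lam e) (hα : 0 < α) (hK : K = numAbove lam α)
    {j : ℕ} (hj : j < K) : √α < lam j :=
  (Real.sqrt_lt' (lt_of_le_of_ne (h.nonneg j) fun h0 => by
    have := (h.lt_numAbove_iff hα j).1 (hK ▸ hj)
    rw [← h0] at this
    norm_num at this
    linarith)).2 ((h.lt_numAbove_iff hα j).1 (hK ▸ hj))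

theorem IsEigenSystem.le_sqrt (h : IsEigenSystem T lam e) (hα : 0 < α) (hK : K = numAbove lam α)
    {j : ℕ} (hj : K ≤ j) : lam j ≤ √α :=
  Real.le_sqrt_of_sq_le (not_lt.1 fun hlt => hj.not_gt (hK ▸ (h.lt_numAbove_iff hα j).2 hlt))

/-- The projection on the span of the first `K` vectors of `e`. -/
noncomputable abbrev spanProj (e : ℕ → H) (K : ℕ) : H →L[ℝ] H := partialDiag 1 e K

theorem norm_spanProj_le (he : Orthonormal ℝ e) (K : ℕ) : ‖spanProj e K‖ ≤ 1 :=
  norm_partialDiag_le he zero_le_one fun j _ => by simp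

/-- Pythagoras: the inner product of `w` with its projection is the squared norm of the projection.
-/
theorem norm_sub_spanProj_apply_le (he : Orthonormal ℝ e) (K : ℕ) (w : H) :
    ‖w - spanProj e K w‖ ≤ ‖w‖ := by
  refine abs_le_of_sq_le_sq' ?_ (by positivity) |>.2
  have h1 := norm_partialDiag_apply_sq he 1 K w
  have h2 := inner_partialDiag_apply 1 e K w
  simp only [Pi.one_apply, one_pow] at h1 h2
  rw [norm_sub_sq_real, real_inner_comm, h2, h1]
  have : 0 ≤ ∑ j ∈ Finset.range K, 1 * inner ℝ (e j) w ^ 2 :=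
    Finset.sum_nonneg fun j _ => by positivity
  linarith

theorem IsEigenSystem.comp_regInv (h : IsEigenSystem T lam e) (hα : 0 < α)
    (hK : K = numAbove lam α) : T ∘L regInv lam e K = spanProj e K := by
  rw [regInv_eq_partialDiag, h.comp_partialDiag]
  refine partialDiag_congr fun j hj => ?_
  exact mul_inv_cancel₀ ((Real.sqrt_nonneg α).trans_lt (h.sqrt_lt hα hK hj)).ne'

theorem IsEigenSystem.norm_regInv_le (h : IsEigenSystem T lam e) (hα : 0 < α)
    (hK : K = numAbove lam α) : ‖regInv lam e K‖ ≤ (√α)⁻¹ := by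
  refine norm_partialDiag_le h.orthonormal (by positivity) fun j hj => ?_
  have := h.sqrt_lt hα hK hj
  rw [abs_of_nonneg (inv_nonneg.2 (h.nonneg j))]
  exact inv_anti₀ (Real.sqrt_pos.2 hα) this.le

theorem IsEigenSystem.norm_regInv_apply_sq_le (h : IsEigenSystem T lam e) (hα : 0 < α)
    (hK : K = numAbove lam α) (w : H) :
    ‖regInv lam e K w‖ ^ 2 ≤ (√α)⁻¹ * inner ℝ (regInv lam e K w) w :=
  norm_partialDiag_apply_sq_le_inner h.orthonormal (fun j _ => inv_nonneg.2 (h.nonneg j))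
    (fun _ hj => inv_anti₀ (Real.sqrt_pos.2 hα) (h.sqrt_lt hα hK hj).le) w

theorem IsEigenSystem.norm_sub_comp_spanProj_le (h : IsEigenSystem T lam e) (hα : 0 < α)
    (hK : K = numAbove lam α) : ‖T - T ∘L spanProj e K‖ ≤ √α := by
  rw [h.comp_partialDiag]
  simp only [Pi.one_apply, mul_one]
  exact h.norm_sub_partialDiag_le (Real.sqrt_nonneg _) fun j hj => h.le_sqrt hα hK hj

variable [CompleteSpace H]

open ContinuousLinearMap (adjoint)

theorem adjoint_tens (a b : H) : adjoint (tens a b) = tens b a :=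
  InnerProductSpace.adjoint_rankOne b a

theorem adjoint_partialDiag (c : ℕ → ℝ) (e : ℕ → H) (K : ℕ) :
    adjoint (partialDiag c e K) = partialDiag c e K := by
  simp [partialDiag, adjoint_tens]

theorem adjoint_regInv (c : ℕ → ℝ) (e : ℕ → H) (K : ℕ) :
    adjoint (regInv c e K) = regInv c e K := adjoint_partialDiag _ _ _

theorem IsEigenSystem.adjoint_eq (h : IsEigenSystem T lam e) : adjoint T = T := by
  refine tendsto_nhds_unique ?_ h.tendsto_partialDiag
  have := (adjoint (𝕜 := ℝ) (E := H) (F := H)).continuous.continuousAt.tendsto.comp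
    h.tendsto_partialDiag
  refine this.congr fun n => ?_
  simp [adjoint_partialDiag]

theorem IsEigenSystem.regInv_comp (h : IsEigenSystem T lam e) (hα : 0 < α)
    (hK : K = numAbove lam α) : regInv lam e K ∘L T = spanProj e K := by
  have := congrArg adjoint (h.comp_regInv hα hK)
  rwa [ContinuousLinearMap.adjoint_comp, h.adjoint_eq, adjoint_partialDiag, adjoint_regInv] at this

theorem IsEigenSystem.norm_sub_spanProj_comp_le (h : IsEigenSystem T lam e) (hα : 0 < α)
    (hK : K = numAbove lam α) : ‖T - spanProj e K ∘L T‖ ≤ √α := by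
  have := h.norm_sub_comp_spanProj_le hα hK
  rwa [← (adjoint (𝕜 := ℝ) (E := H) (F := H)).norm_map, map_sub, ContinuousLinearMap.adjoint_comp,
    h.adjoint_eq, adjoint_partialDiag] at this

end DiagonalOperators

/-! ### Deterministic bounds for the bias, for `Q̂ - Q` and for the noise -/

section Deterministic

variable {H : Type*} [NormedAddCommGroup H] [InnerProductSpace ℝ H] [CompleteSpace H]

open ContinuousLinearMap (adjoint)

theorem IsHS.adjoint_isHS {T : H →L[ℝ] H} (hT : IsHS T) : IsHS (adjoint T) := by
  rw [isHS_iff] at *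
  rwa [hsNormSq, ← tsum_enorm_adjoint (someBasis H) (someBasis H)]

/-- The operator norm of `T` is at most the Hilbert–Schmidt norm of its adjoint. -/
theorem norm_sq_le_of_hasSum_adjoint {ι : Type*} (b : HilbertBasis ι ℝ H) {T : H →L[ℝ] H} {s : ℝ}
    (hs : HasSum (fun i => ‖adjoint T (b i)‖ ^ 2) s) : ‖T‖ ^ 2 ≤ s := by
  have hs0 : 0 ≤ s := hs.nonneg fun i => by positivity
  suffices ‖T‖ ≤ √s from (Real.le_sqrt (norm_nonneg _) hs0).1 this
  refine ContinuousLinearMap.opNorm_le_bound _ (Real.sqrt_nonneg _) fun ζ => ?_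
  refine abs_le_of_sq_le_sq' ?_ (by positivity) |>.2
  rw [mul_pow, Real.sq_sqrt hs0]
  -- Parseval for `T ζ`; each coefficient is the inner product of `ζ` with `T^* bᵢ`, to which
  -- Cauchy–Schwarz applies.
  have h1 := b.hasSum_inner_mul_inner (T ζ) (T ζ)
  rw [real_inner_self_eq_norm_sq] at h1
  refine hasSum_le (fun i => ?_) h1 (hs.mul_right (‖ζ‖ ^ 2))
  rw [real_inner_comm (T ζ), ← sq, ← ContinuousLinearMap.adjoint_inner_right,
    real_inner_comm, ← mul_pow]
  exact sq_le_sq.2 ((abs_real_inner_le_norm _ _).trans (le_abs_self _))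

/-- If self-adjoint contractions `1 - Π n` converge strongly to `0` and `A` is Hilbert–Schmidt,
then `A (1 - Π n)` converges to `0` in norm. -/
theorem IsHS.tendsto_norm_comp_sub {A : H →L[ℝ] H} (hA : IsHS A) {p : ℕ → H →L[ℝ] H}
    (hp : ∀ n, adjoint (p n) = p n) (hle : ∀ n w, ‖w - p n w‖ ≤ ‖w‖)
    (hlim : ∀ w, Tendsto (fun n => ‖w - p n w‖) atTop (𝓝 0)) :
    Tendsto (fun n => ‖A ∘L p n - A‖) atTop (𝓝 0) := by
  -- The squared norm of `A - A p` is at most the sum of `‖(1 - p) A^* bᵢ‖²`. Each term tends to `0`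
  -- and is dominated by the summable `‖A^* bᵢ‖²`.
  have hsum := (hasSum_normSq (someBasis H) hA.adjoint_isHS).summable
  have hbd : ∀ n i, ‖adjoint A (someBasis H i) - p n (adjoint A (someBasis H i))‖ ^ 2
      ≤ ‖adjoint A (someBasis H i)‖ ^ 2 := fun n i =>
    pow_le_pow_left₀ (norm_nonneg _) (hle _ _) 2
  have h1 : Tendsto (fun n => ∑' i, ‖adjoint A (someBasis H i)
      - p n (adjoint A (someBasis H i))‖ ^ 2) atTop
      (𝓝 (∑' _ : (exists_hilbertBasis ℝ H).choose, (0 : ℝ))) := by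
    refine tendsto_tsum_of_dominated_convergence hsum (fun i => ?_)
      (Eventually.of_forall fun n i => ?_)
    · simpa using (hlim (adjoint A (someBasis H i))).pow 2
    · rw [Real.norm_of_nonneg (by positivity)]
      exact hbd n i
  rw [tsum_zero] at h1
  have h2 : Tendsto (fun n => ‖A ∘L p n - A‖ ^ 2) atTop (𝓝 0) := by
    refine squeeze_zero (fun n => by positivity) (fun n => ?_) h1
    rw [norm_sub_rev]
    refine norm_sq_le_of_hasSum_adjoint (someBasis H) ?_
    have : adjoint (A - A ∘L p n) = adjoint A - p n ∘L adjoint A := by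
      rw [map_sub, ContinuousLinearMap.adjoint_comp, hp]
    simp only [this, sub_apply, ContinuousLinearMap.comp_apply]
    exact (hsum.of_nonneg_of_le (fun i => by positivity) (hbd n)).hasSum
  simpa using h2.sqrt

/-- If `Qn → Q` in norm, and `Q` is self-adjoint and injective, then the spectral projections of
`Qn` for the eigenvalues whose square exceeds `α n → 0` converge strongly to the identity. -/
theorem tendsto_sub_spanProj {Q : H →L[ℝ] H} (hQ : adjoint Q = Q) (hker : ∀ ζ, Q ζ = 0 → ζ = 0)
    {Qn : ℕ → H →L[ℝ] H} (hlim : Tendsto (fun n => ‖Qn n - Q‖) atTop (𝓝 0)) {lam : ℕ → ℕ → ℝ}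
    {e : ℕ → ℕ → H} (hes : ∀ n, IsEigenSystem (Qn n) (lam n) (e n)) {α : ℕ → ℝ}
    (hα : ∀ n, 0 < α n) (hα0 : Tendsto α atTop (𝓝 0)) {K : ℕ → ℕ}
    (hK : ∀ n, K n = numAbove (lam n) (α n)) (w : H) :
    Tendsto (fun n => ‖w - spanProj (e n) (K n) w‖) atTop (𝓝 0) := by
  -- On the range of `Q`, replace `Q` by `Qn` at cost `‖Qn - Q‖ ‖ζ‖`; what the projection drops from
  -- `Qn` has norm at most `√α`.
  have hrange : ∀ ζ, Tendsto (fun n => ‖Q ζ - spanProj (e n) (K n) (Q ζ)‖) atTop (𝓝 0) := by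
    intro ζ
    have h0 : Tendsto (fun n => ‖Qn n - Q‖ * ‖ζ‖ + √(α n) * ‖ζ‖) atTop (𝓝 0) := by
      simpa using (hlim.mul_const ‖ζ‖).add (hα0.sqrt.mul_const ‖ζ‖)
    refine squeeze_zero (fun _ => norm_nonneg _) (fun n => ?_) h0
    have h1 := norm_sub_spanProj_apply_le (hes n).orthonormal (K n) ((Q - Qn n) ζ)
    have h2 := (Qn n - spanProj (e n) (K n) ∘L Qn n).le_of_opNorm_le
      ((hes n).norm_sub_spanProj_comp_le (hα n) (hK n)) ζ
    have h3 := (Q - Qn n).le_opNorm ζ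
    rw [norm_sub_rev] at h3
    refine le_trans (le_of_eq ?_) ((norm_add_le _ _).trans (add_le_add (h1.trans h3) h2))
    simp only [sub_apply, ContinuousLinearMap.comp_apply, map_sub]
    congr 1
    abel
  -- The orthogonal complement of the range of a self-adjoint operator is its kernel.
  have hdense : Dense (Set.range Q) := by
    have : (LinearMap.range (Q : H →ₗ[ℝ] H)).topologicalClosure = ⊤ := by
      rw [Submodule.topologicalClosure_eq_top_iff, Submodule.eq_bot_iff]
      intro ζ hζ
      refine hker ζ (ext_inner_right ℝ fun ξ => ?_)
      rw [inner_zero_left, ← hQ, ContinuousLinearMap.adjoint_inner_left, real_inner_comm]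
      exact hζ (Q ξ) ⟨ξ, rfl⟩
    exact Submodule.dense_iff_topologicalClosure_eq_top.2 this
  rw [Metric.tendsto_atTop]
  intro ε hε
  obtain ⟨_, ⟨ζ, rfl⟩, hζ⟩ := Metric.mem_closure_iff.1 (hdense w) (ε / 2) (half_pos hε)
  obtain ⟨N, hN⟩ := Metric.tendsto_atTop.1 (hrange ζ) (ε / 2) (half_pos hε)
  refine ⟨N, fun n hn => ?_⟩
  have h1 := hN n hn
  have h2 := norm_sub_spanProj_apply_le (hes n).orthonormal (K n) (w - Q ζ)
  rw [dist_zero_right, norm_norm] at h1 ⊢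
  rw [dist_eq_norm] at hζ
  calc _ = ‖(w - Q ζ - spanProj (e n) (K n) (w - Q ζ))
        + (Q ζ - spanProj (e n) (K n) (Q ζ))‖ := by
        rw [map_sub]; congr 1; abel
    _ < ε := (norm_add_le _ _).trans_lt (by linarith)

variable {C C' B V U X : H →L[ℝ] H} {lam : ℕ → ℝ} {e : ℕ → H} {α : ℝ} {K : ℕ}

/-- In the expansion, every regularized inverse adjacent to `C'` collapses with it to a projection
of norm at most `1`. Only the term quadratic in `V` pays the factor `α^(-1/2)`. -/
theorem IsEigenSystem.norm_sandwich_sub_le (h : IsEigenSystem C' lam e) (hα : 0 < α)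
    (hK : K = numAbove lam α) (hX : X = C' ∘L adjoint B + V) :
    ‖adjoint X ∘L regInv lam e K ∘L X - B ∘L C ∘L adjoint B‖
      ≤ ‖B‖ * (‖C' - C‖ + √α) * ‖B‖ + 2 * (‖B‖ * ‖V‖) + ‖V‖ * (√α)⁻¹ * ‖V‖ := by
  have hexp : adjoint X ∘L regInv lam e K ∘L X - B ∘L C ∘L adjoint B
      = B ∘L ((C' - C) - (C' - C' ∘L spanProj e K)) ∘L adjoint B
        + B ∘L spanProj e K ∘L V + adjoint V ∘L spanProj e K ∘L adjoint B
        + adjoint V ∘L regInv lam e K ∘L V := by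
    have e1 : ∀ ζ, C' (regInv lam e K ζ) = spanProj e K ζ :=
      DFunLike.congr_fun (h.comp_regInv hα hK)
    have e2 : ∀ ζ, regInv lam e K (C' ζ) = spanProj e K ζ :=
      DFunLike.congr_fun (h.regInv_comp hα hK)
    have hadj : adjoint X = B ∘L C' + adjoint V := by
      rw [hX, map_add, ContinuousLinearMap.adjoint_comp, h.adjoint_eq,
        ContinuousLinearMap.adjoint_adjoint]
    rw [hadj, hX]
    ext ζ
    simp only [sub_apply, add_apply,
      ContinuousLinearMap.comp_apply, map_add, map_sub, e1, e2]
    abel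
  have hB : ‖adjoint B‖ = ‖B‖ := (adjoint (𝕜 := ℝ) (E := H) (F := H)).norm_map B
  have hV : ‖adjoint V‖ = ‖V‖ := (adjoint (𝕜 := ℝ) (E := H) (F := H)).norm_map V
  have hcomp : ∀ (R S T : H →L[ℝ] H) (s : ℝ), ‖S‖ ≤ s → ‖R ∘L S ∘L T‖ ≤ ‖R‖ * s * ‖T‖ := by
    intro R S T s hs
    calc _ ≤ ‖R‖ * (‖S‖ * ‖T‖) := (ContinuousLinearMap.opNorm_comp_le _ _).trans
          (by gcongr; exact ContinuousLinearMap.opNorm_comp_le _ _)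
      _ ≤ _ := by rw [← mul_assoc]; gcongr
  have hp := norm_spanProj_le h.orthonormal K
  rw [hexp]
  have t1 := hcomp B ((C' - C) - (C' - C' ∘L spanProj e K)) (adjoint B) _
    ((norm_sub_le _ _).trans (add_le_add le_rfl (h.norm_sub_comp_spanProj_le hα hK)))
  have t2 := hcomp B (spanProj e K) V _ hp
  have t3 := hcomp (adjoint V) (spanProj e K) (adjoint B) _ hp
  have t4 := hcomp (adjoint V) (regInv lam e K) V _ (h.norm_regInv_le hα hK)
  rw [hB] at t1 t3
  rw [hV] at t3 t4
  refine (norm_add₄_le).trans ?_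
  linarith

/-- Submultiplicativity would give `α⁻¹ α'⁻¹ ‖X‖²` in place of `α^(-1/2) α'^(-1/2)`. The gain comes
from bounding the square of `R w` by the quadratic form of the first inverse `R` at `w = X r`, which
is the form of `X^* R X` at `r` and is undone by the second inverse. -/
theorem IsEigenSystem.norm_noise_sq_le {lam' : ℕ → ℝ} {e' : ℕ → H} {α' : ℝ} {K' : ℕ}
    (h : IsEigenSystem C lam e) (hα : 0 < α) (hK : K = numAbove lam α)
    (h' : IsEigenSystem (adjoint X ∘L regInv lam e K ∘L X) lam' e') (hα' : 0 < α')
    (hK' : K' = numAbove lam' α') :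
    ‖adjoint U ∘L regInv lam e K ∘L X ∘L regInv lam' e' K'‖ ^ 2
      ≤ ‖U‖ ^ 2 * ((√α)⁻¹ * (√α')⁻¹) := by
  set c := ‖U‖ ^ 2 * ((√α)⁻¹ * (√α')⁻¹) with hc
  have hc0 : 0 ≤ c := by positivity
  suffices ‖adjoint U ∘L regInv lam e K ∘L X ∘L regInv lam' e' K'‖ ≤ √c from
    (Real.le_sqrt (norm_nonneg _) hc0).1 this
  refine ContinuousLinearMap.opNorm_le_bound _ (Real.sqrt_nonneg _) fun ζ => ?_
  refine abs_le_of_sq_le_sq' ?_ (by positivity) |>.2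
  rw [mul_pow, Real.sq_sqrt hc0]
  set r := regInv lam' e' K' ζ with hr
  set w := X r
  have hU : ‖adjoint U‖ = ‖U‖ := (adjoint (𝕜 := ℝ) (E := H) (F := H)).norm_map U
  have h1 := h.norm_regInv_apply_sq_le hα hK w
  have h2 : inner ℝ (regInv lam e K w) w = inner ℝ (spanProj e' K' ζ) r := by
    rw [← h'.comp_regInv hα' hK', ← ContinuousLinearMap.adjoint_inner_left]
    rfl
  have h3 : inner ℝ (spanProj e' K' ζ) r ≤ (√α')⁻¹ * ‖ζ‖ ^ 2 := by
    calc _ ≤ ‖spanProj e' K' ζ‖ * ‖r‖ := real_inner_le_norm _ _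
      _ ≤ (1 * ‖ζ‖) * ((√α')⁻¹ * ‖ζ‖) := by
        gcongr
        · exact ContinuousLinearMap.le_of_opNorm_le _ (norm_spanProj_le h'.orthonormal K') ζ
        · exact ContinuousLinearMap.le_of_opNorm_le _ (h'.norm_regInv_le hα' hK') ζ
      _ = _ := by ring
  calc ‖adjoint U (regInv lam e K w)‖ ^ 2 ≤ (‖U‖ * ‖regInv lam e K w‖) ^ 2 := by
        gcongr
        rw [← hU]
        exact ContinuousLinearMap.le_opNorm _ _
    _ = ‖U‖ ^ 2 * ‖regInv lam e K w‖ ^ 2 := mul_pow _ _ _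
    _ ≤ ‖U‖ ^ 2 * ((√α)⁻¹ * ((√α')⁻¹ * ‖ζ‖ ^ 2)) := by
        gcongr
        refine h1.trans ?_
        rw [h2]
        gcongr
    _ = _ := by rw [hc]; ring

/-- `C_xz^* C_zz⁻¹ C_xz = B C_zz B^*` if `C_xz = C_zz B^*`. -/
theorem IsEigenSystem.popQ_eq (h : IsEigenSystem C lam e) (hpos : ∀ j, 0 < lam j)
    (hX : X = C ∘L adjoint B) : popQ X lam e = B ∘L C ∘L adjoint B := by
  have hadj : adjoint X = B ∘L C := by
    rw [hX, ContinuousLinearMap.adjoint_comp, h.adjoint_eq, ContinuousLinearMap.adjoint_adjoint]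
  -- The spectral series of `C`, multiplied by `B` and `B^*`, matches `popQ` term by term: the two
  -- factors `C` in `X^*` and `X` contribute `lam²`, of which the unbounded inverse removes one
  -- `lam`.
  have h1 := (h.hasSum.mapL ((ContinuousLinearMap.compL ℝ H H H).flip (adjoint B))).mapL
    (ContinuousLinearMap.compL ℝ H H H B)
  refine HasSum.tsum_eq (h1.congr_fun fun j => ?_)
  ext ζ
  rw [hadj, hX]
  have h2 : inner ℝ (e j) (C (adjoint B ζ)) = lam j * inner ℝ (e j) (adjoint B ζ) := by
    rw [← ContinuousLinearMap.adjoint_inner_left, h.adjoint_eq, h.apply_eq, real_inner_smul_left]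
  have h3 : (lam j)⁻¹ * (lam j * inner ℝ (e j) (adjoint B ζ) * lam j)
      = lam j * inner ℝ (e j) (adjoint B ζ) := by
    field_simp [(hpos j).ne']
  simp [tens_apply, h2, h.apply_eq, smul_smul, h3]

end Deterministic

/-! ### Strong law of large numbers for stationary mixing sequences -/

section LawOfLargeNumbers

variable {Ω : Type*} [MeasurableSpace Ω] {P : Measure Ω}

/-- Nonnegative functions with summable integrals converge to `0` almost everywhere. -/
theorem ae_tendsto_zero_of_integral_le {f : ℕ → Ω → ℝ} (hf : ∀ k, Integrable (f k) P)
    (hf0 : ∀ k ω, 0 ≤ f k ω) {b : ℕ → ℝ} (hb : Summable b) (hle : ∀ k, ∫ ω, f k ω ∂P ≤ b k) :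
    ∀ᵐ ω ∂P, Tendsto (fun k => f k ω) atTop (𝓝 0) := by
  have hfin : ∫⁻ ω, ∑' k, ENNReal.ofReal (f k ω) ∂P ≠ ∞ := by
    rw [lintegral_tsum fun k => (hf k).aemeasurable.ennreal_ofReal]
    refine ne_top_of_le_ne_top hb.tsum_ofReal_ne_top (ENNReal.tsum_le_tsum fun k => ?_)
    rw [← ofReal_integral_eq_lintegral_ofReal (hf k) (ae_of_all _ (hf0 k))]
    exact ENNReal.ofReal_le_ofReal (hle k)
  filter_upwards [ae_lt_top' (AEMeasurable.tsum
    fun k => (hf k).aemeasurable.ennreal_ofReal) hfin] with ω hω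
  have h1 := ENNReal.tendsto_atTop_zero_of_tsum_ne_top hω.ne
  have h2 := (ENNReal.tendsto_toReal ENNReal.zero_ne_top).comp h1
  simpa [Function.comp_def, ENNReal.toReal_ofReal (hf0 _ ω)] using h2

/-- The variance of a sum of bounded variables whose covariances decay geometrically grows at most
linearly. -/
theorem integral_sum_sq_le [IsProbabilityMeasure P] {X : ℕ → Ω → ℝ} (hX : ∀ t, Measurable (X t))
    (hX1 : ∀ t ω, |X t ω| ≤ 1) {c ρ : ℝ} (hc : 0 ≤ c) (hρ : 0 ≤ ρ) (hρ1 : ρ < 1)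
    (hcov : ∀ t k, |∫ ω, X t ω * X (t + k) ω ∂P| ≤ c * ρ ^ k) (n : ℕ) :
    ∫ ω, (∑ t ∈ Finset.range n, X t ω) ^ 2 ∂P ≤ n * (2 * c / (1 - ρ)) := by
  have hint : ∀ s t, Integrable (fun ω => X s ω * X t ω) P := fun s t =>
    .of_bound ((hX s).mul (hX t)).aestronglyMeasurable 1 (ae_of_all _ fun ω => by
      rw [Real.norm_eq_abs, abs_mul]
      exact mul_le_one₀ (hX1 s ω) (abs_nonneg _) (hX1 t ω))
  have hsq : ∀ n, Integrable (fun ω => (∑ t ∈ Finset.range n, X t ω) ^ 2) P := fun n => by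
    simp only [sq, Finset.sum_mul_sum]
    exact integrable_finsetSum _ fun s _ => integrable_finsetSum _ fun t _ => hint s t
  induction n with
  | zero => simp
  | succ n ih =>
    have hexp : ∀ ω, (∑ t ∈ Finset.range (n + 1), X t ω) ^ 2 = (∑ t ∈ Finset.range n, X t ω) ^ 2
        + (∑ t ∈ Finset.range n, 2 * (X t ω * X n ω) + X n ω * X n ω) := fun ω => by
      rw [Finset.sum_range_succ, ← Finset.mul_sum, ← Finset.sum_mul]
      ring
    have h2 : ∀ t, Integrable (fun ω => 2 * (X t ω * X n ω)) P := fun t =>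
      (hint t n).const_mul 2
    simp only [hexp]
    have h2' : Integrable (fun ω => ∑ t ∈ Finset.range n, 2 * (X t ω * X n ω) + X n ω * X n ω) P :=
      (integrable_finsetSum _ fun t _ => h2 t).add (hint n n)
    rw [integral_add (hsq n) h2', integral_add (integrable_finsetSum _ fun t _ => h2 t) (hint n n),
      integral_finsetSum _ fun t _ => h2 t]
    simp only [integral_const_mul]
    have h3 : ∀ t ∈ Finset.range n, 2 * ∫ ω, X t ω * X n ω ∂P ≤ 2 * (c * ρ ^ (n - t)) := by
      intro t ht
      have := (le_abs_self _).trans (hcov t (n - t))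
      rw [Nat.add_sub_of_le (Finset.mem_range.1 ht).le] at this
      linarith
    -- Doubling the diagonal bound makes it the term `t = n` of the geometric sum.
    have h4 : ∫ ω, X n ω * X n ω ∂P ≤ 2 * (c * ρ ^ (n - n)) := by
      have := (le_abs_self _).trans (hcov n 0)
      simp only [add_zero, pow_zero, mul_one, Nat.sub_self] at this ⊢
      linarith
    have h5 := add_le_add (Finset.sum_le_sum h3) h4
    rw [← Finset.sum_range_succ (fun t => 2 * (c * ρ ^ (n - t)))] at h5
    simp only [← Finset.mul_sum] at h5 ⊢
    have h6 : ∑ t ∈ Finset.range (n + 1), ρ ^ (n - t) ≤ (1 - ρ)⁻¹ := by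
      have := Finset.sum_range_reflect (fun k => ρ ^ k) (n + 1)
      simp only [Nat.add_sub_cancel] at this
      rw [this, ← tsum_geometric_of_lt_one hρ hρ1]
      exact (summable_geometric_of_lt_one hρ hρ1).sum_le_tsum _ fun k _ => pow_nonneg hρ k
    have h7 : 2 * (c * ∑ t ∈ Finset.range (n + 1), ρ ^ (n - t)) ≤ 2 * c / (1 - ρ) := by
      rw [div_eq_mul_inv, mul_assoc]
      gcongr
    push_cast
    linarith

/-- If the partial sums of the nonnegative sequence `a` converge after normalization along the
squares, they converge. -/
theorem tendsto_average_of_tendsto_sq {a : ℕ → ℝ} (ha : ∀ t, 0 ≤ a t) {p : ℝ}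
    (h : Tendsto (fun k : ℕ => (∑ t ∈ Finset.range ((k + 1) ^ 2), a t) / ((k + 1) ^ 2 : ℕ))
      atTop (𝓝 p)) :
    Tendsto (fun n : ℕ => (∑ t ∈ Finset.range n, a t) / n) atTop (𝓝 p) := by
  refine tendsto_div_of_monotone_of_exists_subseq_tendsto_div _ _ (fun m n hmn =>
    Finset.sum_le_sum_of_subset_of_nonneg (Finset.range_mono hmn) fun t _ _ => ha t)
    fun b hb => ⟨fun k => (k + 1) ^ 2, ?_, ?_, h⟩
  -- Ratios of consecutive squares tend to `1`, so monotone partial sums cannot oscillate between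
  -- them.
  · have h1 : Tendsto (fun k : ℕ => (1 + 1 / ((k : ℝ) + 1)) ^ 2) atTop (𝓝 1) := by
      simpa using (tendsto_one_div_add_atTop_nhds_zero_nat (𝕜 := ℝ)).const_add 1 |>.pow 2
    filter_upwards [h1.eventually_le_const hb] with k hk
    have h2 : ((((k + 1 + 1) ^ 2 : ℕ)) : ℝ) = (1 + 1 / ((k : ℝ) + 1)) ^ 2 * ((k + 1) ^ 2 : ℕ) := by
      push_cast
      field_simp
    rw [h2]
    gcongr
  · exact (tendsto_pow_atTop two_ne_zero).comp (tendsto_add_atTop_nat 1)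

variable {E : Type*} [MeasurableSpace E]

theorem IsStationary.map_eq {w : ℕ → Ω → E} (hst : IsStationary P w) (hw : ∀ t, Measurable (w t))
    (t : ℕ) : P.map (w t) = P.map (w 0) := by
  induction t with
  | zero => rfl
  | succ t ih =>
    have h := congrArg (Measure.map fun q : ℕ → E => q t) hst
    rw [Measure.map_map (measurable_pi_apply t) (measurable_pi_lambda _ fun s => hw (s + 1)),
      Measure.map_map (measurable_pi_apply t) (measurable_pi_lambda _ fun s => hw s)] at h
    exact h.trans ih

theorem measurableSet_sigmaOn {Ω : Type*} {w : ℕ → Ω → E} {I : Set ℕ} {t : ℕ} (ht : t ∈ I) {S : Set E}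
    (hS : MeasurableSet S) : MeasurableSet[sigmaOn w I] (w t ⁻¹' S) :=
  le_iSup₂ (f := fun t (_ : t ∈ I) => MeasurableSpace.comap (w t) inferInstance) t ht _
    ⟨S, hS, rfl⟩

/-- The strong law of large numbers for the frequencies of a stationary geometrically mixing
sequence. -/
theorem ae_tendsto_frequency [IsProbabilityMeasure P] {w : ℕ → Ω → E}
    (hw : ∀ t, Measurable (w t)) (hst : IsStationary P w) (hmix : IsGeomStronglyMixing P w)
    {S : Set E} (hS : MeasurableSet S) :
    ∀ᵐ ω ∂P, Tendsto (fun n : ℕ => (∑ t ∈ Finset.range n, S.indicator (fun _ => (1 : ℝ)) (w t ω))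
      / n) atTop (𝓝 ((P.map (w 0)).real S)) := by
  obtain ⟨C, ρ, hρ0, hρ1, hC⟩ := hmix
  set p := (P.map (w 0)).real S with hp
  have hpt : ∀ t, P.real (w t ⁻¹' S) = p := fun t => by
    rw [hp, ← hst.map_eq hw t, map_measureReal_apply (hw t) hS]
  have hp01 : 0 ≤ p ∧ p ≤ 1 := by
    rw [← hpt 0]
    exact ⟨measureReal_nonneg, measureReal_le_one⟩
  set X : ℕ → Ω → ℝ := fun t ω => S.indicator (fun _ => (1 : ℝ)) (w t ω) - p with hXdef
  have hind : ∀ t, Measurable fun ω => S.indicator (fun _ => (1 : ℝ)) (w t ω) := fun t =>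
    (measurable_const.indicator hS).comp (hw t)
  have hX : ∀ t, Measurable (X t) := fun t => (hind t).sub_const p
  have hX1 : ∀ t ω, |X t ω| ≤ 1 := fun t ω => by
    simp only [hXdef, Set.indicator]
    rw [abs_le]
    split_ifs <;> constructor <;> linarith
  have hindi : ∀ t, Integrable (fun ω => S.indicator (fun _ => (1 : ℝ)) (w t ω)) P := fun t =>
    .of_bound (hind t).aestronglyMeasurable 1 (ae_of_all _ fun ω => by
      simp only [Set.indicator]; split_ifs <;> simp)
  have hcov : ∀ t k, |∫ ω, X t ω * X (t + k) ω ∂P| ≤ |C| * ρ ^ k := by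
    intro t k
    have h1 := hC k t _ _ (measurableSet_sigmaOn (I := Set.Iic t) (t := t) (Set.mem_Iic.2 le_rfl) hS)
      (measurableSet_sigmaOn (I := Set.Ici (t + k)) (t := t + k) (Set.mem_Ici.2 le_rfl) hS)
    have hexp : ∀ ω, X t ω * X (t + k) ω
        = (w t ⁻¹' S ∩ w (t + k) ⁻¹' S).indicator (fun _ => (1 : ℝ)) ω
          - p * S.indicator (fun _ => (1 : ℝ)) (w t ω)
          - p * S.indicator (fun _ => (1 : ℝ)) (w (t + k) ω) + p * p := fun ω => by
      simp only [hXdef, Set.indicator, Set.mem_inter_iff, Set.mem_preimage]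
      by_cases a : w t ω ∈ S <;> by_cases b : w (t + k) ω ∈ S <;> simp [a, b] <;> ring
    have hm : MeasurableSet (w t ⁻¹' S ∩ w (t + k) ⁻¹' S) := (hw t hS).inter (hw _ hS)
    have hone : ∀ s, ∫ ω, S.indicator (fun _ => (1 : ℝ)) (w s ω) ∂P = p := fun s => by
      rw [← hpt s]
      exact integral_indicator_one (hw s hS)
    have hi1 : Integrable ((w t ⁻¹' S ∩ w (t + k) ⁻¹' S).indicator (fun _ => (1 : ℝ))) P :=
      (integrable_const 1).indicator hm
    have : ∫ ω, X t ω * X (t + k) ω ∂P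
        = P.real (w t ⁻¹' S ∩ w (t + k) ⁻¹' S) - P.real (w t ⁻¹' S) * P.real (w (t + k) ⁻¹' S) := by
      simp only [hexp]
      have hi2 : Integrable (fun ω => (w t ⁻¹' S ∩ w (t + k) ⁻¹' S).indicator (fun _ => (1 : ℝ)) ω
          - p * S.indicator (fun _ => (1 : ℝ)) (w t ω)) P := hi1.sub ((hindi t).const_mul p)
      have hi3 : Integrable (fun ω => (w t ⁻¹' S ∩ w (t + k) ⁻¹' S).indicator (fun _ => (1 : ℝ)) ω
          - p * S.indicator (fun _ => (1 : ℝ)) (w t ω)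
          - p * S.indicator (fun _ => (1 : ℝ)) (w (t + k) ω)) P :=
        hi2.sub ((hindi _).const_mul p)
      rw [integral_add hi3 (integrable_const _), integral_sub hi2
        ((hindi _).const_mul p), integral_sub hi1 ((hindi t).const_mul p), integral_const_mul,
        integral_const_mul, hone, hone, hpt, hpt, integral_const]
      have := integral_indicator_one (μ := P) hm
      simp only [Pi.one_def] at this
      rw [this]
      simp
    rw [this]
    exact h1.trans (by gcongr; exact le_abs_self C)
  set c' := 2 * |C| / (1 - ρ) with hc'
  -- Along sample sizes `N = (k + 1)²` the mean square of the centered average is at most `c' / N`,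
  -- which is summable in `k`.
  set f : ℕ → Ω → ℝ := fun k ω =>
    ((∑ t ∈ Finset.range ((k + 1) ^ 2), X t ω) / ((k + 1) ^ 2 : ℕ)) ^ 2 with hf
  have hfi : ∀ k, Integrable (f k) P := fun k =>
    .of_bound (((Finset.measurable_fun_sum _ fun t _ => hX t).div_const _).pow_const
      2).aestronglyMeasurable 1 (ae_of_all _ fun ω => by
        rw [hf, Real.norm_eq_abs, abs_pow, abs_div, Nat.abs_cast]
        refine pow_le_one₀ (by positivity) (div_le_one_of_le₀ ?_ (by positivity))
        refine (Finset.abs_sum_le_sum_abs _ _).trans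
          ((Finset.sum_le_card_nsmul _ _ 1 fun t _ => hX1 t ω).trans ?_)
        simp)
  have hsum : Summable fun k : ℕ => c' * (1 / ((k + 1 : ℕ) : ℝ) ^ 2) :=
    ((summable_nat_add_iff 1).2 (Real.summable_one_div_nat_pow.2 one_lt_two)).mul_left c'
  have hae := ae_tendsto_zero_of_integral_le hfi (fun k ω => sq_nonneg _) hsum (fun k => by
    have h1 := integral_sum_sq_le hX hX1 (abs_nonneg C) hρ0.le hρ1 hcov ((k + 1) ^ 2)
    simp only [hf, div_pow, integral_div]
    rw [div_le_iff₀ (by positivity)]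
    refine h1.trans (le_of_eq ?_)
    push_cast
    rw [hc']
    field_simp)
  filter_upwards [hae] with ω hω
  -- Interpolation between squares needs nonnegative summands, hence the return to uncentered
  -- indicators.
  refine tendsto_average_of_tendsto_sq (fun t => Set.indicator_nonneg (fun _ _ => zero_le_one) _) ?_
  have h1 : Tendsto (fun k => √(f k ω)) atTop (𝓝 0) := by simpa using hω.sqrt
  simp only [hf, Real.sqrt_sq_eq_abs] at h1
  have h2 := (tendsto_zero_iff_abs_tendsto_zero _).2 h1
  have h3 := h2.add_const p
  rw [zero_add] at h3
  refine h3.congr fun k => ?_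
  have : (((k + 1) ^ 2 : ℕ) : ℝ) ≠ 0 := by positivity
  simp only [hXdef, Finset.sum_sub_distrib, Finset.sum_const, Finset.card_range, nsmul_eq_mul]
  field_simp
  ring

variable {G : Type*} [NormedAddCommGroup G] [NormedSpace ℝ G] [CompleteSpace G]

theorem ae_tendsto_average_simpleFunc {w : ℕ → Ω → E} {Q : Measure E} [IsProbabilityMeasure Q]
    (hfreq : ∀ S, MeasurableSet S → ∀ᵐ ω ∂P, Tendsto (fun n : ℕ =>
      (∑ t ∈ Finset.range n, S.indicator (fun _ => (1 : ℝ)) (w t ω)) / n) atTop (𝓝 (Q.real S)))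
    (φ : SimpleFunc E G) :
    ∀ᵐ ω ∂P, Tendsto (fun n : ℕ => (n : ℝ)⁻¹ • ∑ t ∈ Finset.range n, φ (w t ω)) atTop
      (𝓝 (∫ e, φ e ∂Q)) := by
  induction φ using SimpleFunc.induction with
  | const c hS =>
    rename_i S
    filter_upwards [hfreq S hS] with ω hω
    have h1 := hω.smul_const c
    have h2 : ∀ e, (SimpleFunc.piecewise S hS (SimpleFunc.const E c) (SimpleFunc.const E 0)) e
        = S.indicator (fun _ => (1 : ℝ)) e • c := fun e => by
      by_cases he : e ∈ S <;> simp [he]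
    simp only [h2]
    rw [integral_smul_const, show ∫ e, S.indicator (fun _ => (1 : ℝ)) e ∂Q = Q.real S from
      integral_indicator_one hS]
    refine h1.congr fun n => ?_
    rw [← Finset.sum_smul, smul_smul, div_eq_inv_mul]
  | add hd hf hg =>
    filter_upwards [hf, hg] with ω h1 h2
    simp only [SimpleFunc.coe_add, Pi.add_apply, Finset.sum_add_distrib, smul_add]
    rw [integral_add (SimpleFunc.integrable_of_isFiniteMeasure _)
      (SimpleFunc.integrable_of_isFiniteMeasure _)]
    exact h1.add h2

/-- If the frequencies of all measurable sets converge almost surely, then so do the averages of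
bounded strongly measurable functions with values in a Banach space. -/
theorem ae_tendsto_average {w : ℕ → Ω → E} {Q : Measure E} [IsProbabilityMeasure Q]
    (hfreq : ∀ S, MeasurableSet S → ∀ᵐ ω ∂P, Tendsto (fun n : ℕ =>
      (∑ t ∈ Finset.range n, S.indicator (fun _ => (1 : ℝ)) (w t ω)) / n) atTop (𝓝 (Q.real S)))
    {F : E → G} (hF : StronglyMeasurable F) {M : ℝ} (hM0 : 0 ≤ M) (hM : ∀ e, ‖F e‖ ≤ M) :
    ∀ᵐ ω ∂P, Tendsto (fun n : ℕ => (n : ℝ)⁻¹ • ∑ t ∈ Finset.range n, F (w t ω)) atTop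
      (𝓝 (∫ e, F e ∂Q)) := by
  set φ := hF.approxBounded M
  have hφM : ∀ k e, ‖φ k e‖ ≤ M := hF.norm_approxBounded_le hM0
  have hφ : ∀ e, Tendsto (fun k => φ k e) atTop (𝓝 (F e)) := fun e =>
    hF.tendsto_approxBounded_of_norm_le (hM e)
  -- Off `S k j` the simple approximation is uniformly good; on it the error is at most `2 M`, and
  -- its frequency is controlled by the strong law. Countably many such sets suffice, so one null
  -- set serves them all.
  set S : ℕ → ℕ → Set E := fun k j => {e | 1 / ((j : ℝ) + 1) ≤ ‖φ k e - F e‖}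
  have hd : ∀ k, Measurable fun e => ‖φ k e - F e‖ := fun k =>
    ((φ k).stronglyMeasurable.sub hF).norm.measurable
  have hS : ∀ k j, MeasurableSet (S k j) := fun k j => measurableSet_le measurable_const (hd k)
  have hSlim : ∀ j, Tendsto (fun k => Q.real (S k j)) atTop (𝓝 0) := fun j => by
    have h1 := tendstoInMeasure_of_tendsto_ae (μ := Q)
      (fun k => (φ k).stronglyMeasurable.aestronglyMeasurable) (ae_of_all _ hφ)
    have h2 := tendstoInMeasure_iff_norm.1 h1 (1 / ((j : ℝ) + 1)) (by positivity)
    exact (ENNReal.tendsto_toReal ENNReal.zero_ne_top).comp h2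
  have hφi : ∀ k, Integrable (φ k) Q := fun k => (φ k).integrable_of_isFiniteMeasure
  have hFi : Integrable F Q := .of_bound hF.aestronglyMeasurable M (ae_of_all _ hM)
  have hbd : ∀ (k j : ℕ) (e : E), ‖φ k e - F e‖
      ≤ 1 / ((j : ℝ) + 1) + 2 * M * (S k j).indicator (fun _ => (1 : ℝ)) e := by
    intro k j e
    by_cases he : e ∈ S k j
    · rw [Set.indicator_of_mem he]
      have : 0 ≤ 1 / ((j : ℝ) + 1) := by positivity
      linarith [norm_sub_le (φ k e) (F e), hφM k e, hM e]
    · rw [Set.indicator_of_notMem he, mul_zero, add_zero]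
      exact (not_le.1 he).le
  have hae1 : ∀ᵐ ω ∂P, ∀ k j, Tendsto (fun n : ℕ => (∑ t ∈ Finset.range n,
      (S k j).indicator (fun _ => (1 : ℝ)) (w t ω)) / n) atTop (𝓝 (Q.real (S k j))) :=
    ae_all_iff.2 fun k => ae_all_iff.2 fun j => hfreq _ (hS k j)
  have hae2 : ∀ᵐ ω ∂P, ∀ k, Tendsto (fun n : ℕ => (n : ℝ)⁻¹ • ∑ t ∈ Finset.range n,
      φ k (w t ω)) atTop (𝓝 (∫ e, φ k e ∂Q)) :=
    ae_all_iff.2 fun k => ae_tendsto_average_simpleFunc hfreq _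
  filter_upwards [hae1, hae2] with ω h1 h2
  rw [Metric.tendsto_atTop]
  intro ε hε
  obtain ⟨j, hj⟩ := exists_nat_one_div_lt (show 0 < ε / 6 by positivity)
  -- The `+ 1` in `2 * M + 1` covers the case `M = 0`.
  obtain ⟨k, hk⟩ := ((hSlim j).eventually_lt_const
    (show 0 < ε / (6 * (2 * M + 1)) by positivity)).exists
  have hk' : 2 * M * (ε / (6 * (2 * M + 1))) ≤ ε / 6 := by
    rw [mul_div_assoc', div_le_div_iff₀ (by positivity) (by norm_num)]
    nlinarith
  have hint : ‖∫ e, φ k e ∂Q - ∫ e, F e ∂Q‖ ≤ ε / 3 := by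
    rw [← integral_sub (hφi k) hFi]
    refine (norm_integral_le_integral_norm _).trans ?_
    have hi : Integrable ((S k j).indicator fun _ => (1 : ℝ)) Q :=
      (integrable_const 1).indicator (hS k j)
    calc _ ≤ ∫ e, (1 / ((j : ℝ) + 1) + 2 * M * (S k j).indicator (fun _ => (1 : ℝ)) e) ∂Q :=
          integral_mono ((hφi k).sub hFi).norm
            ((integrable_const _).add (hi.const_mul _)) (hbd k j)
      _ = 1 / ((j : ℝ) + 1) + 2 * M * Q.real (S k j) := by
          rw [integral_add (integrable_const _) (hi.const_mul _), integral_const,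
            integral_const_mul, show ∫ e, (S k j).indicator (fun _ => (1 : ℝ)) e ∂Q
              = Q.real (S k j) from integral_indicator_one (hS k j)]
          simp
      _ ≤ _ := by nlinarith
  have hlim1 := (h1 k j).eventually_lt_const hk
  have hlim2 := Metric.tendsto_atTop.1 (h2 k) (ε / 3) (by positivity)
  obtain ⟨N2, hN2⟩ := hlim2
  obtain ⟨N1, hN1⟩ := eventually_atTop.1 hlim1
  refine ⟨max N1 (max N2 1), fun n hn => ?_⟩
  have hn1 := hN1 n (le_of_max_le_left hn)
  have hn2 := hN2 n (le_of_max_le_left (le_of_max_le_right hn))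
  have hn0 : (0 : ℝ) < n := Nat.cast_pos.2 (le_of_max_le_right (le_of_max_le_right hn))
  have havg : ‖(n : ℝ)⁻¹ • ∑ t ∈ Finset.range n, φ k (w t ω)
      - (n : ℝ)⁻¹ • ∑ t ∈ Finset.range n, F (w t ω)‖ ≤ ε / 3 := by
    rw [← smul_sub, ← Finset.sum_sub_distrib, norm_smul, norm_inv, RCLike.norm_natCast]
    calc _ ≤ (n : ℝ)⁻¹ * ∑ t ∈ Finset.range n,
          (1 / ((j : ℝ) + 1) + 2 * M * (S k j).indicator (fun _ => (1 : ℝ)) (w t ω)) := by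
          gcongr
          exact norm_sum_le_of_le _ fun t _ => hbd k j _
      _ = 1 / ((j : ℝ) + 1) + 2 * M * ((∑ t ∈ Finset.range n,
          (S k j).indicator (fun _ => (1 : ℝ)) (w t ω)) / n) := by
          rw [Finset.sum_add_distrib, ← Finset.mul_sum]
          simp only [Finset.sum_const, Finset.card_range, nsmul_eq_mul]
          field_simp
      _ ≤ _ := by nlinarith
  rw [dist_eq_norm] at hn2 ⊢
  set a := (n : ℝ)⁻¹ • ∑ t ∈ Finset.range n, φ k (w t ω)
  set b := (n : ℝ)⁻¹ • ∑ t ∈ Finset.range n, F (w t ω)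
  calc ‖b - ∫ e, F e ∂Q‖ = ‖(b - a) + (a - ∫ e, φ k e ∂Q) + (∫ e, φ k e ∂Q - ∫ e, F e ∂Q)‖ := by
        congr 1; abel
    _ ≤ ‖b - a‖ + ‖a - ∫ e, φ k e ∂Q‖ + ‖∫ e, φ k e ∂Q - ∫ e, F e ∂Q‖ := norm_add₃_le
    _ < ε := by rw [norm_sub_rev b a]; linarith

end LawOfLargeNumbers

/-! ### Almost sure growth of the squared norm of a bounded-increment martingale -/

section MartingaleBound

variable {Ω : Type*} [m0 : MeasurableSpace Ω] {P : Measure Ω} [IsProbabilityMeasure P]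

/-- An almost sure bound for the squared norm `D n` of a martingale with bounded increments, in
terms of the increments `D (n + 1) - D n = 2 b n + r n`. -/
theorem ae_eventually_le_mul_log {ℱ : Filtration ℕ m0} {D b r : ℕ → Ω → ℝ} {c : ℝ}
    (hD0 : ∀ ω, D 0 ω = 0) (hDnn : ∀ n ω, 0 ≤ D n ω)
    (hstep : ∀ n ω, D (n + 1) ω = D n ω + 2 * b n ω + r n ω) (hr0 : ∀ n ω, 0 ≤ r n ω)
    (hrc : ∀ n ω, r n ω ≤ c) (hb : ∀ n ω, b n ω ^ 2 ≤ D n ω * c)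
    (hDm : ∀ n, StronglyMeasurable[ℱ n] (D n)) (hbm : ∀ n, AEStronglyMeasurable (b n) P)
    (hcond : ∀ n, P[b n | ℱ n] =ᵐ[P] 0) :
    ∀ᵐ ω ∂P, ∀ᶠ n : ℕ in atTop, D n ω ≤ 8 * (n * Real.log n) := by
  obtain ⟨ω₀⟩ : Nonempty Ω := nonempty_of_isProbabilityMeasure P
  have hc0 : 0 ≤ c := (hr0 0 ω₀).trans (hrc 0 ω₀)
  -- A crude sure bound, used only for integrability.
  have hDbd : ∀ n ω, D n ω ≤ n ^ 2 * c := by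
    intro n ω
    induction n with
    | zero => simp [hD0]
    | succ n ih =>
      have h1 : b n ω ≤ n * c := abs_le_of_sq_le_sq' (by
        calc _ ≤ _ := hb n ω
          _ ≤ n ^ 2 * c * c := by gcongr
          _ = _ := by ring) (by positivity) |>.2
      rw [hstep]
      push_cast
      nlinarith [hrc n ω]
  have hbbd : ∀ n ω, |b n ω| ≤ n * c := fun n ω => abs_le.2 (abs_le_of_sq_le_sq' (by
    calc _ ≤ _ := hb n ω
      _ ≤ n ^ 2 * c * c := by gcongr; exact hDbd n ω
      _ = _ := by ring) (by positivity))
  have hDm' : ∀ n, AEStronglyMeasurable (D n) P := fun n =>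
    ((hDm n).mono (ℱ.le n)).aestronglyMeasurable
  have hDi : ∀ n, Integrable (D n) P := fun n =>
    .of_bound (hDm' n) (n ^ 2 * c) (ae_of_all _ fun ω => by
      rw [Real.norm_of_nonneg (hDnn n ω)]; exact hDbd n ω)
  have hbi : ∀ n, Integrable (b n) P := fun n =>
    .of_bound (hbm n) (n * c) (ae_of_all _ fun ω => hbbd n ω)
  have hD2i : ∀ n, Integrable (fun ω => D n ω ^ 2) P := fun n =>
    .of_bound ((hDm' n).pow 2) ((n ^ 2 * c) ^ 2) (ae_of_all _ fun ω => by
      rw [Real.norm_of_nonneg (by positivity)]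
      exact pow_le_pow_left₀ (hDnn n ω) (hDbd n ω) 2)
  have hDbi : ∀ n, Integrable (D n * b n) P := fun n =>
    (hbi n).bdd_mul (c := n ^ 2 * c) (hDm' n) (ae_of_all _ fun ω => by
      rw [Real.norm_of_nonneg (hDnn n ω)]; exact hDbd n ω)
  have hDbcond : ∀ n, P[D n * b n | ℱ n] =ᵐ[P] 0 := fun n => by
    filter_upwards [condExp_mul_of_stronglyMeasurable_left (hDm n) (hDbi n) (hbi n), hcond n]
      with ω h1 h2
    rw [h1, Pi.mul_apply, h2, Pi.zero_apply, mul_zero]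
  have hEb : ∀ n, ∫ ω, b n ω ∂P = 0 := fun n => by
    rw [← integral_condExp (ℱ.le n), integral_congr_ae (hcond n)]
    simp
  have hEDb : ∀ n, ∫ ω, D n ω * b n ω ∂P = 0 := fun n => by
    change ∫ ω, (D n * b n) ω ∂P = 0
    rw [← integral_condExp (ℱ.le n), integral_congr_ae (hDbcond n)]
    simp
  have hED : ∀ n : ℕ, ∫ ω, D n ω ∂P ≤ n * c := by
    intro n
    induction n with
    | zero => simp [hD0]
    | succ n ih =>
      have h2b := (hbi n).const_mul 2
      have hsum : Integrable (fun ω => D n ω + 2 * b n ω) P := (hDi n).add h2b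
      have h1 : ∫ ω, D (n + 1) ω ∂P ≤ ∫ ω, (D n ω + 2 * b n ω + c) ∂P :=
        integral_mono (hDi _) (hsum.add (integrable_const c)) fun ω => by
          simp only [hstep]; linarith [hrc n ω]
      rw [integral_add hsum (integrable_const c), integral_add (hDi n) h2b, integral_const_mul,
        hEb, integral_const] at h1
      simp only [probReal_univ, one_smul] at h1
      push_cast
      linarith
  -- Expanding `(D + 2b + r)²` with `b² ≤ c D` and `r ≤ c` gives `D² + 4 D b + 8 c D + 3 c²`. The `D
  -- b` term has mean zero and `E D ≤ n c`, so each increment fits in `8 c² (2n + 1)`.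
  have hED2 : ∀ n : ℕ, ∫ ω, D n ω ^ 2 ∂P ≤ 8 * c ^ 2 * n ^ 2 := by
    intro n
    induction n with
    | zero => simp [hD0]
    | succ n ih =>
      have h4 : Integrable (fun ω => 4 * (D n ω * b n ω)) P := (hDbi n).const_mul 4
      have h8 : Integrable (fun ω => 8 * c * D n ω) P := (hDi n).const_mul _
      have hs1 : Integrable (fun ω => D n ω ^ 2 + 4 * (D n ω * b n ω)) P := (hD2i n).add h4
      have hs2 : Integrable (fun ω => D n ω ^ 2 + 4 * (D n ω * b n ω) + 8 * c * D n ω) P :=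
        hs1.add h8
      have h1 : ∫ ω, D (n + 1) ω ^ 2 ∂P
          ≤ ∫ ω, (D n ω ^ 2 + 4 * (D n ω * b n ω) + 8 * c * D n ω + 3 * c ^ 2) ∂P :=
        integral_mono (hD2i _) (hs2.add (integrable_const _)) fun ω => by
          simp only [hstep]
          have h1 : r n ω ^ 2 ≤ c ^ 2 := pow_le_pow_left₀ (hr0 n ω) (hrc n ω) 2
          have h2 : D n ω * r n ω ≤ D n ω * c := mul_le_mul_of_nonneg_left (hrc n ω) (hDnn n ω)
          nlinarith [hb n ω, sq_nonneg (b n ω - r n ω)]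
      rw [integral_add hs2 (integrable_const _), integral_add hs1 h8, integral_add (hD2i n) h4,
        integral_const_mul, integral_const_mul, hEDb, integral_const] at h1
      simp only [probReal_univ, one_smul] at h1
      have h2 := mul_le_mul_of_nonneg_left (hED n) (by positivity : 0 ≤ 8 * c)
      push_cast
      nlinarith [sq_nonneg c, mul_nonneg (sq_nonneg c) (Nat.cast_nonneg (α := ℝ) n)]
  -- Pointwise the next square is at least `D² + 4 D b`, and `D b` has conditional mean zero.
  have hsub : Submartingale (fun n ω => D n ω ^ 2) ℱ P := by
    refine submartingale_nat (fun n => (hDm n).pow 2) hD2i fun n => ?_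
    have h4 : Integrable (fun ω => 4 * (D n ω * b n ω)) P := (hDbi n).const_mul 4
    have hmono : P[(fun ω => D n ω ^ 2) + (4 : ℝ) • (D n * b n) | ℱ n]
        ≤ᵐ[P] P[fun ω => D (n + 1) ω ^ 2 | ℱ n] :=
      condExp_mono ((hD2i n).add h4) (hD2i _) (ae_of_all _ fun ω => by
        simp only [Pi.add_apply, Pi.smul_apply, Pi.mul_apply, smul_eq_mul, hstep]
        nlinarith [sq_nonneg (2 * b n ω + r n ω), mul_nonneg (hDnn n ω) (hr0 n ω)])
    filter_upwards [hmono, condExp_add (hD2i n) h4 (ℱ n),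
      condExp_smul (μ := P) (4 : ℝ) (D n * b n) (ℱ n), hDbcond n] with ω h1 h2 h3 h5
    refine le_trans (le_of_eq ?_) h1
    have h6 : P[fun ω => D n ω ^ 2 | ℱ n] = fun ω => D n ω ^ 2 :=
      condExp_of_stronglyMeasurable (ℱ.le n) ((hDm n).pow 2) (hD2i n)
    refine Eq.trans ?_ h2.symm
    have h7 : P[fun ω => 4 * (D n ω * b n ω) | ℱ n] ω = 0 := by
      refine h3.trans ?_
      rw [Pi.smul_apply, h5]
      simp
    rw [Pi.add_apply, h6, h7, add_zero]
  -- With this level the maximal inequality up to time `2^(k+1)` yields probability at most `8 c² /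
  -- (k + 1)²`, which is summable; the dependence on `c` then disappears by Borel–Cantelli.
  set thr : ℕ → ℝ := fun k => 2 ^ (k + 1) * (k + 1) with hthr
  have hthr0 : ∀ k, 0 < thr k := fun k => by positivity
  have hBC : ∑' k, P {ω | ((⟨thr k ^ 2, by positivity⟩ : NNReal) : ℝ) ≤
      (Finset.range (2 ^ (k + 1) + 1)).sup' Finset.nonempty_range_add_one
        fun n => D n ω ^ 2} ≠ ∞ := by
    have hs : Summable fun k : ℕ => 8 * c ^ 2 * (1 / ((k + 1 : ℕ) : ℝ) ^ 2) :=
      ((summable_nat_add_iff 1).2 (Real.summable_one_div_nat_pow.2 one_lt_two)).mul_left _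
    refine ne_top_of_le_ne_top hs.tsum_ofReal_ne_top (ENNReal.tsum_le_tsum fun k => ?_)
    have h1 := maximal_ineq hsub (fun n ω => sq_nonneg _)
      (ε := ⟨thr k ^ 2, by positivity⟩) (2 ^ (k + 1))
    have h2 := h1.trans (ENNReal.ofReal_le_ofReal ((setIntegral_le_integral (hD2i _)
      (ae_of_all _ fun ω => sq_nonneg _)).trans (hED2 _)))
    have h3 : ENNReal.ofNNReal ⟨thr k ^ 2, by positivity⟩ = ENNReal.ofReal (thr k ^ 2) :=
      (ENNReal.ofReal_eq_coe_nnreal (by positivity)).symm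
    rw [h3, mul_comm, ← ENNReal.le_div_iff_mul_le (Or.inl (by simp [(hthr0 k).ne']))
      (Or.inl ENNReal.ofReal_ne_top), ← ENNReal.ofReal_div_of_pos (by positivity)] at h2
    refine h2.trans (ENNReal.ofReal_le_ofReal (le_of_eq ?_))
    simp only [hthr]
    push_cast
    field_simp
  filter_upwards [ae_eventually_notMem hBC] with ω hω
  obtain ⟨N, hN⟩ := eventually_atTop.1 hω
  filter_upwards [eventually_ge_atTop (2 ^ (N + 1))] with n hn
  have hn2 : 2 ≤ n := le_trans (by rw [pow_succ]; nlinarith [Nat.one_le_two_pow (n := N)]) hn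
  set k := Nat.log 2 n with hk
  have hk1 : 1 ≤ k := Nat.log_pos one_lt_two hn2
  have hNk : N ≤ k := (Nat.le_succ N).trans (Nat.le_log_of_pow_le one_lt_two hn)
  have h1 := hN k hNk
  simp only [not_le, Finset.sup'_lt_iff] at h1
  have h2 := h1 n (Finset.mem_range.2 ((Nat.lt_pow_succ_log_self one_lt_two n).trans
    (Nat.lt_succ_self _)))
  have h3 : D n ω ≤ thr k := (abs_le_of_sq_le_sq' h2.le (hthr0 k).le).2
  have h4 : (2 : ℝ) ^ k ≤ n := by exact_mod_cast Nat.pow_log_le_self 2 (by omega)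
  have h5 : (k : ℝ) * Real.log 2 ≤ Real.log n := by
    rw [← Real.log_pow]
    exact Real.log_le_log (by positivity) h4
  -- Here `k + 1 ≤ 2k` and `log 2 > 1/2`. Together with `2^(k+1) ≤ 2n` this gives the final constant
  -- `8`.
  have h6 : (k : ℝ) + 1 ≤ 4 * Real.log n := by
    have : (1 : ℝ) ≤ k := by exact_mod_cast hk1
    nlinarith [Real.log_two_gt_d9]
  calc D n ω ≤ 2 ^ (k + 1) * (k + 1) := h3
    _ = 2 * 2 ^ k * (k + 1) := by ring
    _ ≤ 2 * n * (4 * Real.log n) := by gcongr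
    _ = _ := by ring

end MartingaleBound

/-! ### Truncation, to turn almost sure bounds into sure ones -/

section NormTrunc

variable {H : Type*} [NormedAddCommGroup H]

/-- Truncation to the closed ball of radius `c`: vectors outside are replaced by `0`. -/
noncomputable def normTrunc (c : ℝ) : H → H := (Metric.closedBall (0 : H) c).indicator id

theorem normTrunc_eq {c : ℝ} {a : H} (h : ‖a‖ ≤ c) : normTrunc c a = a :=
  Set.indicator_of_mem (by simpa using h) _

theorem norm_normTrunc_le (c : ℝ) (a : H) : ‖normTrunc c a‖ ≤ |c| := by
  simp only [normTrunc, Set.indicator]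
  split_ifs with h
  · exact (by simpa using h : ‖a‖ ≤ c).trans (le_abs_self c)
  · simp

theorem measurable_normTrunc [MeasurableSpace H] [BorelSpace H] (c : ℝ) :
    Measurable (normTrunc c : H → H) :=
  measurable_id.indicator Metric.isClosed_closedBall.measurableSet

end NormTrunc

/-! ### Almost sure rate of sample cross-covariances -/

section TensorMartingale

open TensorProduct

variable {Ω H : Type*} [m0 : MeasurableSpace Ω] {P : Measure Ω}
  [NormedAddCommGroup H] [InnerProductSpace ℝ H]

/-- The operator norm is at most the Hilbert–Schmidt norm, computed in the algebraic tensor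
product. -/
theorem norm_sum_tens_le {ι : Type*} (s : Finset ι) (a b : ι → H) :
    ‖∑ i ∈ s, tens (a i) (b i)‖ ≤ ‖∑ i ∈ s, a i ⊗ₜ[ℝ] b i‖ := by
  refine ContinuousLinearMap.opNorm_le_bound _ (norm_nonneg _) fun ζ => ?_
  set T := ∑ i ∈ s, tens (a i) (b i)
  -- Testing against `ζ ⊗ T ζ` turns `‖T ζ‖²` into an inner product; Cauchy–Schwarz and division by
  -- `‖T ζ‖` finish.
  have h1 : inner ℝ (T ζ) (T ζ) = inner ℝ (∑ i ∈ s, a i ⊗ₜ[ℝ] b i) (ζ ⊗ₜ[ℝ] (T ζ)) := by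
    rw [sum_inner]
    conv_lhs => rw [show T ζ = ∑ i ∈ s, tens (a i) (b i) ζ by simp [T], sum_inner]
    refine Finset.sum_congr rfl fun i _ => ?_
    rw [TensorProduct.inner_tmul, tens_apply, real_inner_smul_left]
    simp [T]
  have h2 := real_inner_le_norm (∑ i ∈ s, a i ⊗ₜ[ℝ] b i) (ζ ⊗ₜ[ℝ] (T ζ))
  rw [← h1, real_inner_self_eq_norm_sq, TensorProduct.norm_tmul, ← mul_assoc, sq] at h2
  rcases (norm_nonneg (T ζ)).eq_or_lt with h0 | h0
  · rw [← h0]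
    positivity
  · exact le_of_mul_le_mul_right h2 h0

variable [CompleteSpace H] [IsProbabilityMeasure P]

/-- The Hilbert–Schmidt norm comes from an inner product, so the squared norm of the partial sums
has increments `2⟪S, u ⊗ z⟫ + ‖u ⊗ z‖²`, as the scalar martingale bound requires. It dominates the
operator norm. -/
theorem ae_eventually_norm_sum_tens_sq_le {ℱ : Filtration ℕ m0} {u z : ℕ → Ω → H}
    (hz : ∀ t, StronglyMeasurable[ℱ t] (z t)) (hu : ∀ t, StronglyMeasurable[ℱ (t + 1)] (u t))
    {m m' : ℝ} (hum : ∀ t ω, ‖u t ω‖ ≤ m) (hzm : ∀ t ω, ‖z t ω‖ ≤ m')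
    (hcond : ∀ t, P[u t | ℱ t] =ᵐ[P] 0) :
    ∀ᵐ ω ∂P, ∀ᶠ n : ℕ in atTop,
      ‖∑ t ∈ Finset.range n, tens (u t ω) (z t ω)‖ ^ 2 ≤ 8 * (n * Real.log n) := by
  obtain ⟨ω₀⟩ : Nonempty Ω := nonempty_of_isProbabilityMeasure P
  have hm0 : 0 ≤ m := (norm_nonneg _).trans (hum 0 ω₀)
  have hm0' : 0 ≤ m' := (norm_nonneg _).trans (hzm 0 ω₀)
  set S : ℕ → Ω → H ⊗[ℝ] H := fun n ω => ∑ t ∈ Finset.range n, u t ω ⊗ₜ[ℝ] z t ω with hS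
  have huℱ : ∀ n, ∀ t ∈ Finset.range n, StronglyMeasurable[ℱ n] (u t) := fun n t ht =>
    (hu t).mono (ℱ.mono (Finset.mem_range.1 ht))
  have hzℱ : ∀ n, ∀ t ∈ Finset.range n, StronglyMeasurable[ℱ n] (z t) := fun n t ht =>
    (hz t).mono (ℱ.mono (Finset.mem_range.1 ht).le)
  have htm : ∀ {m1 : MeasurableSpace Ω} {f g : Ω → H}, StronglyMeasurable[m1] f →
      StronglyMeasurable[m1] g → StronglyMeasurable[m1] fun ω => f ω ⊗ₜ[ℝ] g ω :=
    fun hf hg => TensorProduct.continuous_tmul.comp_stronglyMeasurable (hf.prodMk hg)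
  have hSm : ∀ n, StronglyMeasurable[ℱ n] (S n) := fun n =>
    Finset.stronglyMeasurable_fun_sum _ fun t ht => htm (huℱ n t ht) (hzℱ n t ht)
  have hu' : ∀ n, StronglyMeasurable (u n) := fun n => (hu n).mono (ℱ.le _)
  have hz' : ∀ n, StronglyMeasurable (z n) := fun n => (hz n).mono (ℱ.le _)
  -- Contracting with `z n`, known at time `n`, moves the cross term from the algebraic tensor
  -- product, which need not be complete, to an inner product in `H` that is linear in `u n`;
  -- conditioning takes place there.
  set w : ℕ → Ω → H := fun n ω => ∑ t ∈ Finset.range n, inner ℝ (z t ω) (z n ω) • u t ω with hw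
  have hwm : ∀ n, StronglyMeasurable[ℱ n] (w n) := fun n =>
    Finset.stronglyMeasurable_fun_sum _ fun t ht =>
      ((hzℱ n t ht).inner (𝕜 := ℝ) (hz n)).smul (huℱ n t ht)
  have hbw : ∀ n ω, inner ℝ (S n ω) (u n ω ⊗ₜ[ℝ] z n ω) = inner ℝ (w n ω) (u n ω) :=
    fun n ω => by
      simp only [hS, hw, sum_inner, TensorProduct.inner_tmul, real_inner_smul_left]
      exact Finset.sum_congr rfl fun t _ => mul_comm _ _
  have hwbd : ∀ n ω, ‖w n ω‖ ≤ n * (m' * m' * m) := fun n ω => by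
    refine (norm_sum_le_of_le (n := fun _ => m' * m' * m) _ fun t _ => ?_).trans_eq (by simp)
    rw [norm_smul]
    have := norm_inner_le_norm (𝕜 := ℝ) (z t ω) (z n ω)
    have h1 : ‖z t ω‖ * ‖z n ω‖ ≤ m' * m' := by
      gcongr
      exacts [hzm _ _, hzm _ _]
    gcongr
    exacts [this.trans h1, hum _ _]
  have hui : ∀ n, Integrable (u n) P := fun n =>
    .of_bound (hu' n).aestronglyMeasurable m (ae_of_all _ (hum n))
  have hwu : ∀ n, Integrable (fun ω => inner ℝ (w n ω) (u n ω)) P := fun n =>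
    .of_bound (((hwm n).mono (ℱ.le n)).inner (hu' n)).aestronglyMeasurable
      (n * (m' * m' * m) * m) (ae_of_all _ fun ω => by
        refine (norm_inner_le_norm _ _).trans ?_
        gcongr
        exacts [hwbd n ω, hum n ω])
  have hmain := ae_eventually_le_mul_log (P := P) (ℱ := ℱ) (D := fun n ω => ‖S n ω‖ ^ 2)
    (b := fun n ω => inner ℝ (S n ω) (u n ω ⊗ₜ[ℝ] z n ω))
    (r := fun n ω => ‖u n ω ⊗ₜ[ℝ] z n ω‖ ^ 2) (c := (m * m') ^ 2)
    (fun ω => by simp [hS]) (fun n ω => by positivity)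
    (fun n ω => by
      rw [← norm_add_sq_real]
      simp only [hS, Finset.sum_range_succ])
    (fun n ω => by positivity)
    (fun n ω => by
      rw [TensorProduct.norm_tmul]
      gcongr
      exacts [hum _ _, hzm _ _])
    (fun n ω => by
      rw [← mul_pow, ← sq_abs]
      refine pow_le_pow_left₀ (abs_nonneg _) ((abs_real_inner_le_norm (S n ω) _).trans ?_) 2
      rw [TensorProduct.norm_tmul]
      gcongr
      exacts [hum _ _, hzm _ _])
    (fun n => (hSm n).norm.pow 2)
    (fun n => by simp only [hbw]; exact (hwu n).aestronglyMeasurable)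
    (fun n => by
      simp only [hbw]
      have h1 := condExp_bilin_of_stronglyMeasurable_left (innerSL ℝ) (hwm n) (hwu n) (hui n)
      filter_upwards [h1, hcond n] with ω h2 h3
      refine h2.trans ?_
      rw [h3]
      simp)
  filter_upwards [hmain] with ω hω
  filter_upwards [hω] with n hn
  exact (pow_le_pow_left₀ (norm_nonneg _) (norm_sum_tens_le _ _ _) 2).trans hn

variable [TopologicalSpace.SeparableSpace H] [MeasurableSpace H] [BorelSpace H]

/-- The information sets `past z e t` form a filtration. -/
def pastFiltration {z e : ℕ → Ω → H} (hz : ∀ t, Measurable (z t)) (he : ∀ t, Measurable (e t)) :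
    Filtration ℕ m0 where
  seq := past z e
  mono' _ _ hst := sup_le_sup (biSup_mono fun _ h => le_trans h hst)
    (biSup_mono fun _ h => lt_of_lt_of_le h hst)
  le' _ := sup_le (iSup₂_le fun s _ => (hz s).comap_le) (iSup₂_le fun s _ => (he s).comap_le)

/-- The almost sure rate of the sample cross-covariance of bounded martingale differences `e t`
with bounded instruments `z t`. -/
theorem ae_eventually_norm_sampleCov_sq_le {z e : ℕ → Ω → H} (hz : ∀ t, Measurable (z t))
    (he : ∀ t, Measurable (e t)) {m m' : ℝ} (hem : ∀ᵐ ω ∂P, ∀ t, ‖e t ω‖ ≤ m)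
    (hzm : ∀ᵐ ω ∂P, ∀ t, ‖z t ω‖ ≤ m') (hcond : ∀ t, P[e t | past z e t] =ᵐ[P] 0) :
    ∀ᵐ ω ∂P, ∀ᶠ T : ℕ in atTop, ‖sampleCov e z T ω‖ ^ 2 ≤ 8 * (Real.log T / T) := by
  have : SecondCountableTopology H := UniformSpace.secondCountable_of_separable H
  -- The truncated variables are bounded everywhere, still adapted, and almost surely equal to the
  -- originals, so the conditional means do not change.
  have hmain := ae_eventually_norm_sum_tens_sq_le (P := P) (ℱ := pastFiltration hz he)
    (u := fun t ω => normTrunc m (e t ω)) (z := fun t ω => normTrunc m' (z t ω))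
    (fun t => by
      refine Measurable.stronglyMeasurable ((measurable_normTrunc m').comp (Measurable.of_comap_le ?_))
      exact le_sup_of_le_left (le_iSup₂_of_le t (Set.mem_Iic.2 le_rfl) le_rfl))
    (fun t => by
      refine Measurable.stronglyMeasurable ((measurable_normTrunc m).comp (Measurable.of_comap_le ?_))
      exact le_sup_of_le_right (le_iSup₂_of_le t (Set.mem_Iio.2 t.lt_succ_self) le_rfl))
    (fun t ω => norm_normTrunc_le _ _) (fun t ω => norm_normTrunc_le _ _)
    (fun t => (condExp_congr_ae (by
      filter_upwards [hem] with ω hω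
      exact normTrunc_eq (hω t))).trans (hcond t))
  filter_upwards [hmain, hem, hzm] with ω h1 h2 h3
  filter_upwards [h1, eventually_gt_atTop 0] with T hT hT0
  simp only [normTrunc_eq (h2 _), normTrunc_eq (h3 _)] at hT
  have hT0' : (0 : ℝ) < T := Nat.cast_pos.2 hT0
  rw [sampleCov, norm_smul, norm_inv, RCLike.norm_natCast, mul_pow]
  calc _ ≤ ((T : ℝ)⁻¹) ^ 2 * (8 * (T * Real.log T)) := by gcongr
    _ = _ := by field_simp

end TensorMartingale

/-! ### Error decomposition and convergence of `Ĉ_zz` -/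

section Consistency

variable {Ω H : Type*} [MeasurableSpace Ω] {P : Measure Ω}
  [NormedAddCommGroup H] [InnerProductSpace ℝ H]

open ContinuousLinearMap (adjoint)

theorem norm_tens (a b : H) : ‖tens a b‖ = ‖b‖ * ‖a‖ := InnerProductSpace.norm_rankOne b a

theorem continuous_tens : Continuous fun q : H × H => tens q.1 q.2 :=
  (InnerProductSpace.rankOne ℝ (E := H) (F := H)).continuous₂.comp continuous_swap

theorem tens_add_left (a a' b : H) : tens (a + a') b = tens a b + tens a' b := by
  ext ζ
  simp [tens_apply, inner_add_left, add_smul]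

theorem aestronglyMeasurable_tens [TopologicalSpace.SeparableSpace H] [MeasurableSpace H]
    [BorelSpace H] {a b : Ω → H} (ha : Measurable a) (hb : Measurable b) :
    AEStronglyMeasurable (fun ω => tens (a ω) (b ω)) P := by
  have : SecondCountableTopology H := UniformSpace.secondCountable_of_separable H
  exact continuous_tens.comp_aestronglyMeasurable (f := fun ω => (a ω, b ω))
    (ha.prodMk hb).stronglyMeasurable.aestronglyMeasurable

variable [CompleteSpace H]

theorem tens_apply_left (L : H →L[ℝ] H) (a b : H) : tens (L a) b = tens a b ∘L adjoint L := by
  ext ζ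
  simp [tens_apply, ContinuousLinearMap.adjoint_inner_right]

theorem sampleCov_linear {Ω : Type*} {L : H →L[ℝ] H} {a b e z : ℕ → Ω → H} {ω : Ω}
    (h : ∀ t, b t ω = L (a t ω) + e t ω) (T : ℕ) :
    sampleCov b z T ω = sampleCov a z T ω ∘L adjoint L + sampleCov e z T ω := by
  simp only [sampleCov, h, tens_add_left, tens_apply_left, Finset.sum_add_distrib, smul_add,
    ContinuousLinearMap.smul_comp, ContinuousLinearMap.finsetSum_comp]

theorem adjoint_crossCov {a b : Ω → H} : adjoint (crossCov P a b) = crossCov P b a := by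
  rw [crossCov, crossCov]
  have := ((adjoint (𝕜 := ℝ) (E := H) (F := H)).toContinuousLinearEquiv).integral_comp_comm
    (μ := P) (fun ω => tens (a ω) (b ω))
  simpa [adjoint_tens] using this.symm

theorem crossCov_linear {L : H →L[ℝ] H} {a b e z : Ω → H} (h : ∀ᵐ ω ∂P, b ω = L (a ω) + e ω)
    (ha : Integrable (fun ω => tens (a ω) (z ω)) P) (he : Integrable (fun ω => tens (e ω) (z ω)) P) :
    crossCov P b z = crossCov P a z ∘L adjoint L + crossCov P e z := by
  have h1 : crossCov P b z = ∫ ω, (((ContinuousLinearMap.compL ℝ H H H).flip (adjoint L))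
      (tens (a ω) (z ω)) + tens (e ω) (z ω)) ∂P := by
    refine integral_congr_ae ?_
    filter_upwards [h] with ω hω
    rw [hω, tens_add_left, tens_apply_left]
    rfl
  rw [h1, integral_add (ContinuousLinearMap.integrable_comp _ ha) he,
    ContinuousLinearMap.integral_comp_comm _ ha]
  rfl

/-- The estimation error splits into a regularization bias and a noise term. -/
theorem f2slse_sub_eq {Ω : Type*} {x y z u : ℕ → Ω → H} {A : H →L[ℝ] H}
    {μ' ν' : ℕ → ℝ} {g' h' : ℕ → H} {K₁ K₂ T : ℕ} {ω : Ω} {α : ℝ} (hα : 0 < α)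
    (hy : ∀ t, y t ω = A (x t ω) + u t ω)
    (hν' : IsEigenSystem (sampleQ x z μ' g' K₁ T ω) ν' h') (hK₂ : K₂ = numAbove ν' α) :
    f2slse x y z μ' g' ν' h' K₁ K₂ T ω - A = (A ∘L spanProj h' K₂ - A)
      + adjoint (sampleCov u z T ω) ∘L regInv μ' g' K₁ ∘L sampleCov x z T ω ∘L regInv ν' h' K₂ := by
  -- Writing the projection as `Q̂` times its regularized inverse makes `A Π` the exact contribution
  -- of `A x` to the estimator.
  rw [← hν'.comp_regInv hα hK₂, f2slse, sampleP, sampleCov_linear hy, map_add,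
    ContinuousLinearMap.adjoint_comp, ContinuousLinearMap.adjoint_adjoint, sampleQ]
  ext ζ
  simp only [sub_apply, add_apply, ContinuousLinearMap.comp_apply]
  abel

/-- The strong law of large numbers for the sample covariance operator. -/
theorem ae_tendsto_sampleCov [TopologicalSpace.SeparableSpace H] [MeasurableSpace H]
    [BorelSpace H] [IsProbabilityMeasure P] {x z : ℕ → Ω → H} (hx : ∀ t, Measurable (x t))
    (hz : ∀ t, Measurable (z t)) (hst : IsStationary P fun t ω => (x t ω, z t ω))
    (hmix : IsGeomStronglyMixing P fun t ω => (x t ω, z t ω)) {m : ℝ}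
    (hzm : ∀ᵐ ω ∂P, ∀ t, ‖z t ω‖ ≤ m) :
    ∀ᵐ ω ∂P, Tendsto (fun T => sampleCov z z T ω) atTop (𝓝 (crossCov P (z 0) (z 0))) := by
  have : SecondCountableTopology H := UniformSpace.secondCountable_of_separable H
  have hw : ∀ t, Measurable fun ω => (x t ω, z t ω) := fun t => (hx t).prodMk (hz t)
  have : IsProbabilityMeasure (P.map fun ω => (x 0 ω, z 0 ω)) :=
    Measure.isProbabilityMeasure_map (hw 0).aemeasurable
  -- A function of the pair, since stationarity and mixing are those of `(x, z)`; the truncation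
  -- makes it bounded everywhere.
  set F : H × H → H →L[ℝ] H := fun q => tens (normTrunc m q.2) (normTrunc m q.2) with hF
  have htm : StronglyMeasurable fun q : H × H => normTrunc m q.2 :=
    ((measurable_normTrunc m).comp measurable_snd).stronglyMeasurable
  have hFm : StronglyMeasurable F := continuous_tens.comp_stronglyMeasurable (htm.prodMk htm)
  have hFb : ∀ q, ‖F q‖ ≤ |m| * |m| := fun q => by
    rw [hF, norm_tens]
    gcongr <;> exact norm_normTrunc_le _ _
  have hint : ∫ q, F q ∂(P.map fun ω => (x 0 ω, z 0 ω)) = crossCov P (z 0) (z 0) := by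
    rw [integral_map (hw 0).aemeasurable hFm.aestronglyMeasurable]
    refine integral_congr_ae ?_
    filter_upwards [hzm] with ω hω
    simp only [hF, normTrunc_eq (hω 0)]
  have hlim := ae_tendsto_average (P := P) (fun S hS => ae_tendsto_frequency hw hst hmix hS) hFm
    (by positivity) hFb
  rw [hint] at hlim
  filter_upwards [hlim, hzm] with ω h1 h2
  simp only [hF, normTrunc_eq (h2 _)] at h1
  exact h1

end Consistency

/-! ### Regularization parameters against sampling rates -/

section Rates

theorem tendsto_log_pow_div (k : ℕ) :
    Tendsto (fun T : ℕ => Real.log T ^ k / T) atTop (𝓝 0) :=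
  (Real.isLittleO_pow_log_id_atTop (n := k)).tendsto_div_nhds_zero.comp tendsto_natCast_atTop_atTop

/-- The square of the expression is `log³ T / T` times the quantity in `hrate`. This controls the
term quadratic in `Ĉ_vz`. -/
theorem tendsto_log_sq_div_mul_inv_sqrt {α : ℕ → ℝ} (hα : ∀ T, 0 < α T)
    (hrate : Tendsto (fun T : ℕ => (α T)⁻¹ * (T : ℝ)⁻¹ * Real.log T) atTop (𝓝 0)) :
    Tendsto (fun T : ℕ => Real.log T ^ 2 / T * (√(α T))⁻¹) atTop (𝓝 0) := by
  have h := ((tendsto_log_pow_div 3).mul hrate).sqrt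
  rw [mul_zero, Real.sqrt_zero] at h
  refine h.congr fun T => ?_
  rw [← Real.sqrt_sq (by positivity : 0 ≤ Real.log T ^ 2 / T * (√(α T))⁻¹), mul_pow, inv_pow,
    Real.sq_sqrt (hα T).le]
  congr 1
  ring

variable {H : Type*} [NormedAddCommGroup H] [InnerProductSpace ℝ H] [CompleteSpace H]

open ContinuousLinearMap (adjoint)

/-- The regularized sample operators `X^* C'_{K}⁻¹ X` converge to `B C B^*` in norm if `C' → C` and
the noise `V = X - C' B^*` is small. -/
theorem tendsto_norm_sandwich_sub {C B : H →L[ℝ] H} {C' X V : ℕ → H →L[ℝ] H} {lam : ℕ → ℕ → ℝ}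
    {e : ℕ → ℕ → H} {α : ℕ → ℝ} {K : ℕ → ℕ} (h : ∀ T, IsEigenSystem (C' T) (lam T) (e T))
    (hα : ∀ T, 0 < α T) (hα0 : Tendsto α atTop (𝓝 0))
    (hrate : Tendsto (fun T : ℕ => (α T)⁻¹ * (T : ℝ)⁻¹ * Real.log T) atTop (𝓝 0))
    (hK : ∀ T, K T = numAbove (lam T) (α T)) (hX : ∀ T, X T = C' T ∘L adjoint B + V T)
    (hC : Tendsto C' atTop (𝓝 C)) {c : ℝ}
    (hV : ∀ᶠ T : ℕ in atTop, ‖V T‖ ^ 2 ≤ c * (Real.log T ^ 2 / T)) :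
    Tendsto (fun T => ‖adjoint (X T) ∘L regInv (lam T) (e T) (K T) ∘L X T - B ∘L C ∘L adjoint B‖)
      atTop (𝓝 0) := by
  have hV2 : Tendsto (fun T => ‖V T‖ ^ 2) atTop (𝓝 0) :=
    squeeze_zero' (Eventually.of_forall fun T => by positivity) hV
      (by simpa using (tendsto_log_pow_div 2).const_mul c)
  have hV1 : Tendsto (fun T => ‖V T‖) atTop (𝓝 0) := by simpa using hV2.sqrt
  have hV3 : Tendsto (fun T => ‖V T‖ * (√(α T))⁻¹ * ‖V T‖) atTop (𝓝 0) := by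
    refine squeeze_zero' (Eventually.of_forall fun T => by positivity) ?_
      (by simpa using (tendsto_log_sq_div_mul_inv_sqrt hα hrate).const_mul c)
    filter_upwards [hV] with T hT
    calc _ = ‖V T‖ ^ 2 * (√(α T))⁻¹ := by ring
      _ ≤ c * (Real.log T ^ 2 / T) * (√(α T))⁻¹ := by gcongr
      _ = _ := by ring
  have hC1 := tendsto_iff_norm_sub_tendsto_zero.1 hC
  refine squeeze_zero (fun T => norm_nonneg _)
    (fun T => (h T).norm_sandwich_sub_le (C := C) (hα T) (hK T) (hX T)) ?_
  simpa using ((((hC1.add hα0.sqrt).const_mul ‖B‖).mul_const ‖B‖).add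
    ((hV1.const_mul ‖B‖).const_mul 2)).add hV3

/-- The ratio condition enters through `α ≤ α'` eventually, which replaces `α^(-1/2) α'^(-1/2)` by
`α⁻¹`; the rate condition then matches `‖U‖² = O(log T / T)`. -/
theorem tendsto_norm_noise {U X C : ℕ → H →L[ℝ] H} {lam lam' : ℕ → ℕ → ℝ} {e e' : ℕ → ℕ → H}
    {α α' : ℕ → ℝ} {K K' : ℕ → ℕ} (h : ∀ T, IsEigenSystem (C T) (lam T) (e T))
    (hα : ∀ T, 0 < α T) (hα' : ∀ T, 0 < α' T)
    (hratio : Tendsto (fun T => α T * (α' T)⁻¹) atTop (𝓝 0))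
    (hrate : Tendsto (fun T : ℕ => (α T)⁻¹ * (T : ℝ)⁻¹ * Real.log T) atTop (𝓝 0))
    (hK : ∀ T, K T = numAbove (lam T) (α T))
    (h' : ∀ T, IsEigenSystem (adjoint (X T) ∘L regInv (lam T) (e T) (K T) ∘L X T) (lam' T) (e' T))
    (hK' : ∀ T, K' T = numAbove (lam' T) (α' T)) {c : ℝ}
    (hU : ∀ᶠ T : ℕ in atTop, ‖U T‖ ^ 2 ≤ c * (Real.log T / T)) :
    Tendsto (fun T => ‖adjoint (U T) ∘L regInv (lam T) (e T) (K T) ∘L X T ∘L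
      regInv (lam' T) (e' T) (K' T)‖) atTop (𝓝 0) := by
  suffices Tendsto (fun T => ‖adjoint (U T) ∘L regInv (lam T) (e T) (K T) ∘L X T ∘L
      regInv (lam' T) (e' T) (K' T)‖ ^ 2) atTop (𝓝 0) by simpa using this.sqrt
  refine squeeze_zero' (Eventually.of_forall fun T => by positivity) ?_
    (by simpa using hrate.const_mul c)
  filter_upwards [hU, hratio.eventually_le_const zero_lt_one] with T hT hT1
  have hle : α T ≤ α' T := by
    rwa [← div_eq_mul_inv, div_le_one (hα' T)] at hT1
  have hs := Real.sqrt_pos.2 (hα T)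
  calc _ ≤ ‖U T‖ ^ 2 * ((√(α T))⁻¹ * (√(α' T))⁻¹) :=
        (h T).norm_noise_sq_le (hα T) (hK T) (h' T) (hα' T) (hK' T)
    _ ≤ ‖U T‖ ^ 2 * ((√(α T))⁻¹ * (√(α T))⁻¹) := by gcongr
    _ = ‖U T‖ ^ 2 * (α T)⁻¹ := by rw [← mul_inv, Real.mul_self_sqrt (hα T).le]
    _ ≤ c * (Real.log T / T) * (α T)⁻¹ := by
        have := inv_pos.2 (hα T)
        gcongr
    _ = _ := by ring

end Rates

/-! ### Consequences of the model assumptions -/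

section Assumptions

variable {Ω H : Type*} [MeasurableSpace Ω] {P : Measure Ω}
  [NormedAddCommGroup H] [InnerProductSpace ℝ H] [CompleteSpace H] [MeasurableSpace H]
  {A B : H →L[ℝ] H} {x y z u v : ℕ → Ω → H} {μ : ℕ → ℝ} {g : ℕ → H} {ν : ℕ → ℝ} {h : ℕ → H}

open ContinuousLinearMap (adjoint)

theorem ModelAssumptions.exists_bound_v (hm : ModelAssumptions P A B x y z u v μ g ν h)
    (hs : StrongAssumptions P x z u v) : ∃ m : ℝ, ∀ᵐ ω ∂P, ∀ t, ‖v t ω‖ ≤ m := by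
  obtain ⟨mx, hx⟩ := hs.bounded_x
  obtain ⟨mz, hz⟩ := hs.bounded_z
  refine ⟨mx + ‖B‖ * mz, ?_⟩
  filter_upwards [hx, hz, ae_all_iff.2 hm.first_stage] with ω h1 h2 h3 t
  rw [show v t ω = x t ω - B (z t ω) by rw [h3 t]; abel]
  refine (norm_sub_le _ _).trans (add_le_add (h1 t) ((B.le_opNorm _).trans ?_))
  gcongr
  exact h2 t

variable [IsProbabilityMeasure P] [TopologicalSpace.SeparableSpace H] [BorelSpace H]

/-- The almost sure rate of `Ĉ_vz`, in either case of the last assumption. -/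
theorem ModelAssumptions.ae_norm_sampleCov_vz_le
    (hm : ModelAssumptions P A B x y z u v μ g ν h) (hs : StrongAssumptions P x z u v) :
    ∀ᵐ ω ∂P, ∃ c : ℝ, ∀ᶠ T : ℕ in atTop,
      ‖sampleCov v z T ω‖ ^ 2 ≤ c * (Real.log T ^ 2 / T) := by
  rcases hs.martingale_or_rate with hmart | hrate
  · obtain ⟨mv, hv⟩ := hm.exists_bound_v hs
    obtain ⟨mz, hz⟩ := hs.bounded_z
    filter_upwards [ae_eventually_norm_sampleCov_sq_le hm.measurable_z hm.measurable_v hv hz hmart]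
      with ω hω
    refine ⟨8, ?_⟩
    filter_upwards [hω, (Real.tendsto_log_atTop.comp
      tendsto_natCast_atTop_atTop).eventually_ge_atTop 1] with T h1 h2
    refine h1.trans ?_
    -- The martingale case gives `log T / T`, relaxed here to the squared rate available in the
    -- other case.
    have h3 : Real.log T ≤ Real.log T ^ 2 := le_self_pow₀ h2 two_ne_zero
    gcongr
  · filter_upwards [hrate] with ω hω
    obtain ⟨c, hc⟩ := hω.bound
    refine ⟨c ^ 2, ?_⟩
    filter_upwards [hc] with T hT
    rw [norm_norm] at hT
    refine (pow_le_pow_left₀ (norm_nonneg _) hT 2).trans (le_of_eq ?_)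
    have h1 : ((T : ℝ) ^ (-1 / 2 : ℝ)) ^ 2 = (T : ℝ)⁻¹ := by
      rw [← Real.rpow_natCast, ← Real.rpow_mul (Nat.cast_nonneg T)]
      norm_num
      exact Real.rpow_neg_one _
    rw [mul_pow, Real.norm_eq_abs, sq_abs, mul_pow, h1]
    ring

/-- Insert the first stage: the contribution of `v` is the adjoint of `E[z ⊗ v] = 0`. Boundedness
supplies the integrability needed to split the expectation. -/
theorem ModelAssumptions.crossCov_xz_eq (hm : ModelAssumptions P A B x y z u v μ g ν h)
    (hs : StrongAssumptions P x z u v) :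
    crossCov P (x 0) (z 0) = crossCov P (z 0) (z 0) ∘L adjoint B := by
  obtain ⟨mv, hv⟩ := hm.exists_bound_v hs
  obtain ⟨mz, hz⟩ := hs.bounded_z
  have hint : ∀ {a : Ω → H} {m : ℝ}, Measurable a → (∀ᵐ ω ∂P, ‖a ω‖ ≤ m) →
      Integrable (fun ω => tens (a ω) (z 0 ω)) P := fun {a m} ha hb =>
    .of_bound (aestronglyMeasurable_tens ha (hm.measurable_z 0)) (mz * m) (by
      filter_upwards [hb, hz] with ω h1 h2
      rw [norm_tens]
      exact mul_le_mul (h2 0) h1 (norm_nonneg _) ((norm_nonneg _).trans (h2 0)))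
  rw [crossCov_linear (hm.first_stage 0)
    (hint (hm.measurable_z 0) (hz.mono fun ω hω => hω 0))
    (hint (hm.measurable_v 0) (hv.mono fun ω hω => hω 0)), ← adjoint_crossCov (a := z 0) (b := v 0),
    hm.crossCov_zv, map_zero, add_zero]

end Assumptions

end FIV

/-! ### Strong consistency -/

theorem theorem5 {Ω H : Type*} [MeasurableSpace Ω]
    [NormedAddCommGroup H] [InnerProductSpace ℝ H] [CompleteSpace H]
    [TopologicalSpace.SeparableSpace H] [MeasurableSpace H] [BorelSpace H]
    (P : Measure Ω) [IsProbabilityMeasure P]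
    (A B : H →L[ℝ] H) (x y z u v : ℕ → Ω → H)
    (μ : ℕ → ℝ) (g : ℕ → H) (ν : ℕ → ℝ) (h : ℕ → H)
    (hmodel : FIV.ModelAssumptions P A B x y z u v μ g ν h)
    (hstrong : FIV.StrongAssumptions P x z u v)
    -- the regularization parameters, as functions of the sample size `T`
    (α₁ α₂ : ℕ → ℝ) (hα₁ : ∀ T, 0 < α₁ T) (hα₂ : ∀ T, 0 < α₂ T)
    (hα₁_lim : Tendsto α₁ atTop (𝓝 0)) (hα₂_lim : Tendsto α₂ atTop (𝓝 0))
    (hα_ratio : Tendsto (fun T => α₁ T * (α₂ T)⁻¹) atTop (𝓝 0))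
    (hα₁_rate : Tendsto (fun T : ℕ => (α₁ T)⁻¹ * (T : ℝ)⁻¹ * Real.log T) atTop (𝓝 0))
    -- eigenelements of the sample operators, and the numbers `K₁`, `K₂` of those that are retained
    (μ' : ℕ → Ω → ℕ → ℝ) (g' : ℕ → Ω → ℕ → H) (ν' : ℕ → Ω → ℕ → ℝ) (h' : ℕ → Ω → ℕ → H)
    (K₁ K₂ : ℕ → Ω → ℕ)
    (hμ' : ∀ T ω, FIV.IsEigenSystem (FIV.sampleCov z z T ω) (μ' T ω) (g' T ω))
    (hK₁ : ∀ T ω, K₁ T ω = FIV.numAbove (μ' T ω) (α₁ T))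
    (hν' : ∀ T ω, FIV.IsEigenSystem (FIV.sampleQ x z (μ' T ω) (g' T ω) (K₁ T ω) T ω)
      (ν' T ω) (h' T ω))
    (hK₂ : ∀ T ω, K₂ T ω = FIV.numAbove (ν' T ω) (α₂ T))
    -- the conditions on the spectral gaps
    (hgap : ∀ᵐ ω ∂P, (fun T : ℕ => (∑ j ∈ Finset.range (K₁ T ω), μ j * FIV.tau μ j) *
        ∑ j ∈ Finset.range (K₂ T ω), FIV.tau ν j)
      =o[atTop] fun T : ℕ => (T : ℝ) ^ (1 / 2 : ℝ) * Real.log T ^ (-3 / 2 : ℝ))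
    (htail : ∀ᵐ ω ∂P, Tendsto (fun T => (∑' j, μ (K₁ T ω + j)) *
        ∑ j ∈ Finset.range (K₂ T ω), FIV.tau ν j) atTop (𝓝 0)) :
    ∀ᵐ ω ∂P, Tendsto (fun T => ‖FIV.f2slse x y z (μ' T ω) (g' T ω) (ν' T ω) (h' T ω)
      (K₁ T ω) (K₂ T ω) T ω - A‖) atTop (𝓝 0) := by
  have hxz := hmodel.crossCov_xz_eq hstrong
  have hQ := hmodel.eigen_Czz.popQ_eq hmodel.pos_μ hxz
  obtain ⟨mu, hu⟩ := hstrong.bounded_u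
  obtain ⟨mz, hz⟩ := hstrong.bounded_z
  -- All the randomness enters through these five almost sure events; from here on the sample path
  -- is fixed and the argument is deterministic.
  filter_upwards [ae_all_iff.2 hmodel.model, ae_all_iff.2 hmodel.first_stage,
    hmodel.ae_norm_sampleCov_vz_le hstrong,
    FIV.ae_eventually_norm_sampleCov_sq_le hmodel.measurable_z hmodel.measurable_u hu hz
      hmodel.martingale_u,
    FIV.ae_tendsto_sampleCov hmodel.measurable_x hmodel.measurable_z hmodel.stationary
      hmodel.mixing hz] with ω hy hx ⟨c, hV⟩ hU hC
  have hnoise := FIV.tendsto_norm_noise (fun T => hμ' T ω) hα₁ hα₂ hα_ratio hα₁_rate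
    (fun T => hK₁ T ω) (fun T => hν' T ω) (fun T => hK₂ T ω) hU
  have hQlim := FIV.tendsto_norm_sandwich_sub (fun T => hμ' T ω) hα₁ hα₁_lim hα₁_rate
    (fun T => hK₁ T ω) (FIV.sampleCov_linear hx) hC hV
  rw [← hQ] at hQlim
  have hproj := FIV.tendsto_sub_spanProj hmodel.eigen_Q.adjoint_eq hmodel.ker_Q hQlim
    (fun T => hν' T ω) hα₂ hα₂_lim (fun T => hK₂ T ω)
  have hbias := hmodel.isHS_A.tendsto_norm_comp_sub (fun T => FIV.adjoint_partialDiag _ _ _)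
    (fun T => FIV.norm_sub_spanProj_apply_le (hν' T ω).orthonormal _) hproj
  refine squeeze_zero (fun T => norm_nonneg _) (fun T => ?_) (by simpa using hbias.add hnoise)
  rw [FIV.f2slse_sub_eq (hα₂ T) hy (hν' T ω) (hK₂ T ω)]
  exact norm_add_le _ _
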